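/- **Setting.** Let $\mathcal H$ be a finite-dimensional Hilbert space, identified with $\mathbb C^d$. Let $\mathcal L_{\rm h}(\mathcal H)$ be the real space of Hermitian operators, $\mathcal S(\mathcal H)$ the manifold of strictly positive density operators, and identify each tangent space $T_\rho\mathcal S(\mathcal H)$ with the traceless Hermitian operators. The m-connection $\nabla^{(\rm m)}$ on $\mathcal S(\mathcal H)$ is the flat connection of the ambient affine space $\{A\in\mathcal L_{\rm h}(\mathcal H):\operatorname{Tr}A=1\}$. Let $\langle\cdot,\cdot\rangle_\rho$, $\rho\in\mathcal S(\mathcal H)$, be a family of inner products on $\mathcal L_{\rm h}(\mathcal H)$, smooth in $\rho$, with $\langle A,I\rangle_\rho=\operatorname{Tr}(\rho A)$ for all $A$. For a tangent vector $X$ at $\rho$ let $L_X\in\mathcal L_{\rm h}(\mathcal H)$ be defined by $\langle L_X,A\rangle_\rho=\operatorname{Tr}(XA)$ for all $A\in\mathcal L_{\rm h}(\mathcal H)$, and let $g_\rho(X,Y)=\langle L_X,L_Y\rangle_\rho$. The e-connection $\nabla^{(\rm e)}$ is the dual of $\nabla^{(\rm m)}$ with respect to $g$: $Xg(Y,Z)=g(\nabla^{(\rm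 e)}_XY,Z)+g(Y,\nabla^{(\rm m)}_XZ)$. A model $(M,\xi)$ in $\mathcal S(\mathcal H)$ is a submanifold $M=\{\rho_\xi\mid\xi\in\Xi\}$ with a global coordinate system $\xi=(\xi^1,\dots,\xi^m)$, given by a smooth injective immersion $\xi\mapsto\rho_\xi$ from an open set $\Xi\subset\mathbb R^m$ into $\mathcal S(\mathcal H)$. $M$ is *e-autoparallel* in $\mathcal S(\mathcal H)$ if $\nabla^{(\rm e)}_XY$ is a vector field on $M$ for all vector fields $X,Y$ on $M$. The coordinate system $\xi$ is *m-affine* if all the $\partial/\partial\xi^j$ are parallel for the m-connection $\nabla^{(\rm m)}_M$ of $M$, where $\nabla^{(\rm m)}_M$ is the dual of the connection induced by $\nabla^{(\rm e)}$ with respect to the induced metric: $Xg(Y,Z)=g(\nabla^{(\rm e)}_XY,Z)+g(Y,(\nabla^{(\rm m)}_M)_XZ)$ for all vector fields $X,Y,Z$ on $M$. Let $n\ge 2$. The $n$-fold i.i.d. extension of $(M,\xi)$ is the model $(\tilde M,\tilde\xi)$ in $\mathcal S(\mathcal H^{\otimes n})$ with $\tilde M=\{\rho^{\otimes n}\mid\rho\in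 M\}$ and $\tilde\xi^i(\rho^{\otimes n})=\xi^i(\rho)$. Suppose that families of inner products as above are given on both $\mathcal S(\mathcal H)$ and $\mathcal S(\mathcal H^{\otimes n})$, and consider the condition $$\Bigl\langle\bigotimes_{t=1}^nA_t,\bigotimes_{t=1}^nB_t\Bigr\rangle_{\rho^{\otimes n}}=\prod_{t=1}^n\langle A_t,B_t\rangle_\rho\qquad(\rho\in\mathcal S(\mathcal H)).\tag{$*$}$$ Call the two families *tensor-multiplicative* if $(*)$ holds for all $A_t,B_t\in\mathcal L_{\rm h}(\mathcal H)$, and *one-site multiplicative* if $(*)$ holds for all $A_t,B_t\in\mathcal L_{\rm h}(\mathcal H)$ such that $A_t=I$ for all but at most one $t$. **Proposition.** 1. If the two families are one-site multiplicative, then for every model $(M,\xi)$ in $\mathcal S(\mathcal H)$ the following are equivalent: (i) $M$ is e-autoparallel in $\mathcal S(\mathcal H)$ and $\xi$ is m-affine; (ii) $\tilde M$ is e-autoparallel in $\mathcal S(\mathcal H^{\otimes n})$ and $\tilde\xi$ is m-affine. 2. Tensor-multiplicative families are one-site multiplicative. In particular (i) and (ii) are equivalent for them. 3. If both families are given by the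 same function $f$ through $\langle A,B\rangle_\rho=\operatorname{Tr}\bigl(A\,f(\Delta_\rho)(B)\,\rho\bigr)$, where $\Delta_\rho(V)=\rho V\rho^{-1}$ is the modular operator (as for monotone metrics), then they are one-site multiplicative. 4. The symmetrized inner products $\langle A,B\rangle_\rho=\operatorname{Re}\operatorname{Tr}(\rho AB)$ on $\mathcal S(\mathcal H)$ and $\mathcal S(\mathcal H^{\otimes n})$, which define the SLD structures, are one-site multiplicative. -/

import Mathlib

open scoped ContDiff Matrix ComplexOrder

noncomputable section

set_option linter.unusedSectionVars false

namespace QStat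

/-! ### Hermitian operators and states

The Hilbert space is `ℂ^d` with `d` a finite index type, operators are matrices. -/

/-- The real vector space of Hermitian operators on `ℂ^d`. -/
def Herm (d : Type*) [Fintype d] [DecidableEq d] : Type _ :=
  ↥(selfAdjoint.submodule ℝ (Matrix d d ℂ))

variable {d : Type*} [Fintype d] [DecidableEq d]

/-- A norm on the finite-dimensional space of Hermitian operators (the largest absolute value of a
matrix entry); only its topology matters. -/
instance : NormedAddCommGroup (Herm d) :=
  letI : NormedAddCommGroup (Matrix d d ℂ) := Matrix.normedAddCommGroup
  inferInstanceAs (NormedAddCommGroup ↥(selfAdjoint.submodule ℝ (Matrix d d ℂ)))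

instance : NormedSpace ℝ (Herm d) :=
  letI : NormedAddCommGroup (Matrix d d ℂ) := Matrix.normedAddCommGroup
  letI : NormedSpace ℝ (Matrix d d ℂ) := Matrix.normedSpace
  inferInstanceAs (NormedSpace ℝ ↥(selfAdjoint.submodule ℝ (Matrix d d ℂ)))

instance : FiniteDimensional ℝ (Herm d) :=
  inferInstanceAs (FiniteDimensional ℝ ↥(selfAdjoint.submodule ℝ (Matrix d d ℂ)))

namespace Herm

/-- The underlying matrix. -/
def mat (A : Herm d) : Matrix d d ℂ := Subtype.val A

/-- A Hermitian matrix as an element of `Herm d`. -/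
def mk (A : Matrix d d ℂ) (h : A.IsHermitian) : Herm d := ⟨A, h⟩

theorem isHermitian_mat (A : Herm d) : A.mat.IsHermitian := Subtype.property A

@[ext] theorem ext {A B : Herm d} (h : A.mat = B.mat) : A = B := Subtype.ext h

@[simp] theorem mat_mk (A : Matrix d d ℂ) (h : A.IsHermitian) : (mk A h).mat = A := rfl
@[simp] theorem mat_add (A B : Herm d) : (A + B).mat = A.mat + B.mat := rfl
@[simp] theorem mat_zero : (0 : Herm d).mat = 0 := rfl
@[simp] theorem mat_smul (c : ℝ) (A : Herm d) : (c • A).mat = c • A.mat := rfl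

end Herm

/-- The identity operator. -/
def idOp : Herm d := Herm.mk 1 Matrix.isHermitian_one

/-- The Hilbert-Schmidt form `Tr (A B)`, a real number for Hermitian `A`, `B`. -/
def hs : LinearMap.BilinForm ℝ (Herm d) :=
  LinearMap.mk₂ ℝ (fun A B => (Matrix.trace (A.mat * B.mat)).re)
    (fun A A' B => by simp [add_mul])
    (fun c A B => by simp)
    (fun A B B' => by simp [mul_add])
    (fun c A B => by simp)

@[simp] theorem mat_idOp : (idOp : Herm d).mat = 1 := rfl

theorem hs_apply (A B : Herm d) : hs A B = (Matrix.trace (A.mat * B.mat)).re := rfl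

/-- The set `𝒮` of strictly positive density operators. -/
def states (d : Type*) [Fintype d] [DecidableEq d] : Set (Herm d) :=
  {ρ | ρ.mat.PosDef ∧ ρ.mat.trace = 1}

/-- The traceless Hermitian operators. The states form an open subset of the affine space of
Hermitian operators of trace `1`, so this is the tangent space of `𝒮` at each of its points, a
tangent vector `X` being identified with `ι_* X`. -/
def traceless (d : Type*) [Fintype d] [DecidableEq d] : Submodule ℝ (Herm d) :=
  LinearMap.ker (hs (d := d) idOp)

/-- Smooth vector fields on `𝒮` (values outside `𝒮` are irrelevant). -/
def IsVectorField (X : Herm d → Herm d) : Prop :=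
  ContDiffOn ℝ ∞ X (states d) ∧ ∀ ρ ∈ states d, X ρ ∈ traceless d

/-- The m-connection on `𝒮`: the flat connection of the ambient affine space. -/
def mNabla (X Y : Herm d → Herm d) : Herm d → Herm d :=
  fun ρ => lineDeriv ℝ Y ρ (X ρ)

/-! ### Information-geometric structures -/

/-- A family of inner products `⟨·,·⟩_ρ`, `ρ ∈ 𝒮`, on the Hermitian operators, smooth in `ρ`, with
`⟨A, I⟩_ρ = Tr (ρ A)` (values of `form` outside `𝒮` are irrelevant). -/
structure InnerProductFamily (d : Type*) [Fintype d] [DecidableEq d] where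
  form : Herm d → LinearMap.BilinForm ℝ (Herm d)
  symm : ∀ ρ ∈ states d, ∀ A B, form ρ A B = form ρ B A
  pos : ∀ ρ ∈ states d, ∀ A, A ≠ 0 → 0 < form ρ A A
  smooth : ∀ A B, ContDiffOn ℝ ∞ (fun ρ => form ρ A B) (states d)
  unit : ∀ ρ ∈ states d, ∀ A, form ρ A idOp = hs ρ A

namespace InnerProductFamily

variable (G : InnerProductFamily d)

/-- The Hermitian operator `L_X` representing the tangent vector `X` at `ρ`:
`⟨L_X, A⟩_ρ = X⟨A⟩ = Tr (X A)` for all Hermitian `A`. See `eRep_spec`, `eRep_unique`. -/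
def eRep (ρ X : Herm d) : Herm d :=
  Classical.epsilon fun L => ∀ A, G.form ρ L A = hs X A

/-- The Riemannian metric `g_ρ(X, Y) = ⟨L_X, L_Y⟩_ρ`. -/
def metric (ρ X Y : Herm d) : ℝ := G.form ρ (G.eRep ρ X) (G.eRep ρ Y)

/-- `w` is the value at `ρ` of `∇_X Y`, where `∇` is the `g`-dual of the m-connection:
`X g(Y, Z) = g(∇_X Y, Z) + g(Y, ∇^{(m)}_X Z)` for all vector fields `Z` on `𝒮`. -/
def IsENablaAt (X Y : Herm d → Herm d) (ρ w : Herm d) : Prop :=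
  w ∈ traceless d ∧ ∀ Z, IsVectorField Z →
    lineDeriv ℝ (fun σ => G.metric σ (Y σ) (Z σ)) ρ (X ρ)
      = G.metric ρ w (Z ρ) + G.metric ρ (Y ρ) (mNabla X Z ρ)

/-- The e-connection on `𝒮`, the `g`-dual of the m-connection. See `existsUnique_eNabla` for the
existence and uniqueness of the chosen value. -/
def eNabla (X Y : Herm d → Herm d) : Herm d → Herm d :=
  fun ρ => Classical.epsilon fun w => G.IsENablaAt X Y ρ w

end InnerProductFamily

/-! ### Models -/

/-- An `m`-dimensional model `(M, ξ)`: a submanifold `M = {ρ_ξ | ξ ∈ Ξ}` of `𝒮` with a global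
coordinate system `ξ`, given through the parametrization `ξ ↦ ρ_ξ` (the inverse of the chart). -/
structure Model (d : Type*) [Fintype d] [DecidableEq d] (m : ℕ) where
  dom : Set (Fin m → ℝ)
  isOpen_dom : IsOpen dom
  param : (Fin m → ℝ) → Herm d
  smooth : ContDiffOn ℝ ∞ param dom
  mem_states : ∀ ξ ∈ dom, param ξ ∈ states d
  injOn : Set.InjOn param dom
  immersion : ∀ ξ ∈ dom, Function.Injective (fderiv ℝ param ξ)

namespace Model

variable {m : ℕ} (M : Model d m)

/-- Smooth vector fields on `M`, given by their components in the coordinates `ξ`. -/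
def IsField (x : (Fin m → ℝ) → (Fin m → ℝ)) : Prop := ContDiffOn ℝ ∞ x M.dom

/-- The vector field `∑ i, x^i ∂_i` on `M` as an operator-valued function of `ξ`, that is, as a
section along `M` of the tangent bundle of `𝒮`. -/
def push (x : (Fin m → ℝ) → (Fin m → ℝ)) : (Fin m → ℝ) → Herm d :=
  fun ξ => fderiv ℝ M.param ξ (x ξ)

/-- The connection induced by the e-connection along `M`: `∇_X Y` for a vector field `X` on `M` and
a section `Y` along `M` of the tangent bundle of `𝒮`. Writing `Y = ∑ a, y^a E_a` in a frame of
constant (m-parallel) vector fields of `𝒮`, this is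
`∑ a, (X y^a) E_a + ∑ a, y^a ∇_X E_a`. See `eNablaAlong_comp`. -/
def eNablaAlong (G : InnerProductFamily d) (x : (Fin m → ℝ) → (Fin m → ℝ))
    (Y : (Fin m → ℝ) → Herm d) : (Fin m → ℝ) → Herm d :=
  fun ξ => fderiv ℝ Y ξ (x ξ)
    + G.eNabla (fun _ => M.push x ξ) (fun _ => Y ξ) (M.param ξ)

/-- `M` is e-autoparallel in `𝒮`: for all vector fields `X`, `Y` on `M`, the section `∇_X Y` is again
a vector field on `M`. -/
def IsEAutoparallel (G : InnerProductFamily d) : Prop :=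
  ∀ x y, M.IsField x → M.IsField y →
    ∃ z, M.IsField z ∧ ∀ ξ ∈ M.dom, M.eNablaAlong G x (M.push y) ξ = M.push z ξ

/-- The vector field `u` is `∇*_X Z`, where `∇*` is the m-connection of `M`, the dual with respect to
the induced metric of the connection induced on `M` by the e-connection:
`X g(Y, Z) = g(∇_X Y, Z) + g(Y, ∇*_X Z)` for all vector fields `Y` on `M`. -/
def IsMNablaOn (G : InnerProductFamily d) (x z u : (Fin m → ℝ) → (Fin m → ℝ)) : Prop :=
  ∀ y, M.IsField y → ∀ ξ ∈ M.dom,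
    fderiv ℝ (fun η => G.metric (M.param η) (M.push y η) (M.push z η)) ξ (x ξ)
      = G.metric (M.param ξ) (M.eNablaAlong G x (M.push y) ξ) (M.push z ξ)
        + G.metric (M.param ξ) (M.push y ξ) (M.push u ξ)

/-- The coordinate system `ξ` is m-affine: every coordinate vector field `∂_j` is parallel for the
m-connection of `M`. -/
def IsMAffine (G : InnerProductFamily d) : Prop :=
  ∀ (j : Fin m) (x), M.IsField x → M.IsMNablaOn G x (fun _ => Pi.single j 1) (fun _ => 0)

end Model

/-! ### The e-representation and the e-connection are well defined -/

theorem hs_comm (A B : Herm d) : hs A B = hs B A := by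
  simp [hs, Matrix.trace_mul_comm A.mat B.mat]

theorem eq_zero_of_hs_self {A : Herm d} (h : hs A A = 0) : A = 0 := by
  have hA : (A.mat)ᴴ = A.mat := A.2
  have h1 : (Matrix.trace (A.mat * A.mat)).re = 0 := by simpa [hs] using h
  have h2 : 0 ≤ Matrix.trace (A.mat * A.mat) := by
    have := (Matrix.posSemidef_conjTranspose_mul_self A.mat).trace_nonneg
    rwa [hA] at this
  have h3 : Matrix.trace ((A.mat)ᴴ * A.mat) = 0 := by
    rw [hA]
    rw [Complex.le_def] at h2
    apply Complex.ext
    · exact h1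
    · exact h2.2.symm
  exact Herm.ext (Matrix.trace_conjTranspose_mul_self_eq_zero_iff.1 h3)

theorem mem_traceless {A : Herm d} : A ∈ traceless d ↔ hs idOp A = 0 := Iff.rfl

namespace InnerProductFamily

variable (G : InnerProductFamily d)

theorem form_injective {ρ : Herm d} (hρ : ρ ∈ states d) : Function.Injective (G.form ρ) := by
  rw [injective_iff_map_eq_zero]
  intro A hA
  by_contra h
  have := G.pos ρ hρ A h
  rw [hA] at this
  simp at this

theorem exists_eRep {ρ : Herm d} (hρ : ρ ∈ states d) (X : Herm d) :
    ∃ L, ∀ A, G.form ρ L A = hs X A := by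
  have hs' : Function.Surjective (G.form ρ) :=
    (LinearMap.injective_iff_surjective_of_finrank_eq_finrank
      (Subspace.dual_finrank_eq (K := ℝ) (V := Herm d)).symm).1 (G.form_injective hρ)
  obtain ⟨L, hL⟩ := hs' (hs X)
  exact ⟨L, fun A => by rw [hL]⟩

theorem eRep_spec {ρ : Herm d} (hρ : ρ ∈ states d) (X A : Herm d) :
    G.form ρ (G.eRep ρ X) A = hs X A :=
  Classical.epsilon_spec (G.exists_eRep hρ X) A

theorem eRep_unique {ρ : Herm d} (hρ : ρ ∈ states d) {X L : Herm d}
    (h : ∀ A, G.form ρ L A = hs X A) : L = G.eRep ρ X := by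
  apply G.form_injective hρ
  ext A
  rw [h, G.eRep_spec hρ]

theorem metric_eq {ρ : Herm d} (hρ : ρ ∈ states d) (X Y : Herm d) :
    G.metric ρ X Y = hs Y (G.eRep ρ X) := by
  rw [metric, G.symm ρ hρ, G.eRep_spec hρ]

theorem eRep_smul_add {ρ : Herm d} (hρ : ρ ∈ states d) (c : ℝ) (X Y : Herm d) :
    G.eRep ρ (c • X + Y) = c • G.eRep ρ X + G.eRep ρ Y := by
  symm
  apply G.eRep_unique hρ
  intro A
  simp [G.eRep_spec hρ]

theorem metric_self_eq_zero {ρ : Herm d} (hρ : ρ ∈ states d) {X : Herm d}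
    (h : G.metric ρ X X = 0) : X = 0 := by
  have h0 : G.eRep ρ X = 0 := by
    by_contra hne
    exact (G.pos ρ hρ _ hne).ne' h
  apply eq_zero_of_hs_self
  rw [← G.eRep_spec hρ, h0]
  simp

theorem contDiffOn_eRep {E : Type*} [NormedAddCommGroup E] [NormedSpace ℝ E] {s : Set E}
    {r Y : E → Herm d} (hr : ContDiffOn ℝ ∞ r s) (hrs : ∀ x ∈ s, r x ∈ states d)
    (hY : ContDiffOn ℝ ∞ Y s) : ContDiffOn ℝ ∞ (fun x => G.eRep (r x) (Y x)) s := by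
  let T : (Herm d →ₗ[ℝ] Module.Dual ℝ (Herm d)) ≃ₗ[ℝ] (Herm d →L[ℝ] Herm d →L[ℝ] ℝ) :=
    (LinearEquiv.congrRight LinearMap.toContinuousLinearMap).trans LinearMap.toContinuousLinearMap
  have hT : ∀ (F : LinearMap.BilinForm ℝ (Herm d)) A B, T F A B = F A B := fun _ _ _ => rfl
  have hΦ : ContDiffOn ℝ ∞ (fun σ => T (G.form σ)) (states d) := by
    rw [contDiffOn_clm_apply]
    intro A
    rw [contDiffOn_clm_apply]
    intro B
    exact G.smooth A B
  have hΦr : ContDiffOn ℝ ∞ (fun x => T (G.form (r x))) s := hΦ.comp hr hrs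
  have key : ∀ x ∈ s, ∃ e : Herm d ≃L[ℝ] (Herm d →L[ℝ] ℝ), T (G.form (r x)) = e := by
    intro x hx
    have hinj : Function.Injective (T (G.form (r x))).toLinearMap := by
      intro A B hAB
      apply G.form_injective (hrs x hx)
      ext C
      exact congrArg (fun f : Herm d →L[ℝ] ℝ => f C) hAB
    have hfr : Module.finrank ℝ (Herm d) = Module.finrank ℝ (Herm d →L[ℝ] ℝ) := by
      rw [← LinearMap.toContinuousLinearMap.finrank_eq]
      exact (Subspace.dual_finrank_eq (K := ℝ) (V := Herm d)).symm
    exact ⟨(LinearEquiv.ofInjectiveOfFinrankEq _ hinj hfr).toContinuousLinearEquiv, by ext; rfl⟩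
  have hinv : ContDiffOn ℝ ∞ (fun x => (T (G.form (r x))).inverse) s := by
    intro x hx
    obtain ⟨e, he⟩ := key x hx
    have h1 := contDiffAt_map_inverse (n := ∞) e
    rw [← he] at h1
    exact h1.comp_contDiffWithinAt x (hΦr x hx)
  have hH : ContDiffOn ℝ ∞ (fun x => T hs (Y x)) s :=
    (T hs).contDiff.comp_contDiffOn hY
  refine (hinv.clm_apply hH).congr fun x hx => ?_
  obtain ⟨e, he⟩ := key x hx
  symm
  apply G.eRep_unique (hrs x hx)
  intro A
  have : T (G.form (r x)) ((T (G.form (r x))).inverse (T hs (Y x))) = T hs (Y x) := by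
    rw [he, ContinuousLinearMap.inverse_equiv]
    simp
  exact congrArg (fun f : Herm d →L[ℝ] ℝ => f A) this

end InnerProductFamily

theorem continuous_val : Continuous (fun A : Herm d => (A.mat : Matrix d d ℂ)) := by
  let l : Herm d →ₗ[ℝ] (Matrix d d ℂ) := (selfAdjoint.submodule ℝ (Matrix d d ℂ)).subtype
  exact l.continuous_of_finiteDimensional

theorem eventually_posDef {ρ : Herm d} (hρ : ρ.mat.PosDef) :
    ∀ᶠ σ : Herm d in nhds ρ, σ.mat.PosDef := by
  have hK : IsCompact (Metric.sphere (0 : d → ℂ) 1) := isCompact_sphere _ _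
  have hc : Continuous fun p : Herm d × (d → ℂ) => (star p.2 ⬝ᵥ (p.1.mat *ᵥ p.2)).re := by
    have := continuous_val (d := d)
    refine Complex.continuous_re.comp ?_
    refine Continuous.dotProduct (by fun_prop) ?_
    exact Continuous.matrix_mulVec (this.comp continuous_fst) continuous_snd
  have h0 : ∀ᶠ σ in nhds ρ, ∀ x ∈ Metric.sphere (0 : d → ℂ) 1,
      0 < (star x ⬝ᵥ (σ.mat *ᵥ x)).re := by
    refine hK.eventually_forall_of_forall_eventually fun x hx => ?_
    have hx0 : x ≠ 0 := by
      rintro rfl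
      simp at hx
    have hpos : 0 < (star x ⬝ᵥ (ρ.mat *ᵥ x)).re := hρ.re_dotProduct_pos hx0
    exact hc.continuousAt.eventually_const_lt hpos
  filter_upwards [h0] with σ hσ
  have hH : σ.mat.IsHermitian := σ.2
  rw [Matrix.posDef_iff_dotProduct_mulVec]
  refine ⟨hH, fun x hx => ?_⟩
  have hn : ‖x‖ ≠ 0 := norm_ne_zero_iff.2 hx
  have h1 := hσ (((‖x‖⁻¹ : ℝ) : ℂ) • x) (by
    simp only [mem_sphere_iff_norm, sub_zero, norm_smul]
    simp [hn])
  have h2 : star x ⬝ᵥ (σ.mat *ᵥ x) = ((star x ⬝ᵥ (σ.mat *ᵥ x)).re : ℂ) := by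
    apply Complex.ext
    · simp
    · simpa using hH.im_star_dotProduct_mulVec_self x
  rw [h2]
  rw [Complex.zero_lt_real]
  have hn' : 0 < ‖x‖ := norm_pos_iff.2 hx
  rw [Matrix.mulVec_smul, star_smul, dotProduct_smul, smul_dotProduct] at h1
  simp only [smul_eq_mul, Complex.star_def, Complex.conj_ofReal, ← mul_assoc, ← Complex.ofReal_mul,
    Complex.re_ofReal_mul] at h1
  exact (mul_pos_iff_of_pos_left (by positivity)).1 h1

theorem hs_idOp (A : Herm d) : hs idOp A = (A.mat.trace).re := by
  rw [hs_apply, mat_idOp, one_mul]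

theorem eventually_mem_states {ρ v : Herm d} (hρ : ρ ∈ states d) (hv : v ∈ traceless d) :
    ∀ᶠ t : ℝ in nhds 0, ρ + t • v ∈ states d := by
  have hc : Filter.Tendsto (fun t : ℝ => ρ + t • v) (nhds 0) (nhds ρ) := by
    have : Continuous (fun t : ℝ => ρ + t • v) := by fun_prop
    simpa using this.tendsto 0
  filter_upwards [hc.eventually (eventually_posDef hρ.1)] with t ht
  refine ⟨ht, ?_⟩
  apply Complex.ext
  · have : (v.mat.trace).re = 0 := by rw [← hs_idOp]; exact hv
    simp [hρ.2, this]
  · have : star ((ρ + t • v).mat.trace) = ((ρ + t • v).mat.trace) := by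
      have hH : ((ρ + t • v).mat)ᴴ = (ρ + t • v).mat := (ρ + t • v).2
      rw [← Matrix.trace_conjTranspose, hH]
    simpa using Complex.conj_eq_iff_im.1 this

/-- Functions that are differentiable on `𝒮` have line derivatives in tangential directions. -/
theorem hasLineDerivAt_of_states {F : Type*} [NormedAddCommGroup F] [NormedSpace ℝ F]
    {f : Herm d → F} {f' : Herm d →L[ℝ] F} {ρ v : Herm d} (hρ : ρ ∈ states d)
    (hv : v ∈ traceless d) (hf : HasFDerivWithinAt f f' (states d) ρ) :
    HasLineDerivAt ℝ f (f' v) ρ v := by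
  have hline : HasDerivAt (fun t : ℝ => ρ + t • v) v 0 := by
    simpa using ((hasDerivAt_id (0 : ℝ)).smul_const v).const_add ρ
  have hf0 : HasFDerivWithinAt f f' (states d) (ρ + (0 : ℝ) • v) := by simpa using hf
  have h := hf0.comp_hasDerivWithinAt (s := {t : ℝ | ρ + t • v ∈ states d}) 0
    hline.hasDerivWithinAt (fun t ht => ht)
  exact h.hasDerivAt (eventually_mem_states hρ hv)

namespace InnerProductFamily
variable (G : InnerProductFamily d)

theorem isVectorField_const {v : Herm d} (hv : v ∈ traceless d) :
    IsVectorField (fun _ => v) := ⟨contDiffOn_const, fun _ _ => hv⟩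

/-- Product rule for `g(Y, Z)`. -/
theorem lineDeriv_metric {Y Z : Herm d → Herm d} (hY : IsVectorField Y) (hZ : IsVectorField Z)
    {ρ v : Herm d} (hρ : ρ ∈ states d) (hv : v ∈ traceless d) :
    lineDeriv ℝ (fun σ => G.metric σ (Y σ) (Z σ)) ρ v
      = hs (Z ρ) (lineDeriv ℝ (fun σ => G.eRep σ (Y σ)) ρ v)
        + G.metric ρ (Y ρ) (lineDeriv ℝ Z ρ v) := by
  have hL : ContDiffOn ℝ ∞ (fun σ => G.eRep σ (Y σ)) (states d) :=
    G.contDiffOn_eRep contDiffOn_id (fun x hx => hx) hY.1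
  obtain ⟨L', hL'⟩ := (hL.differentiableOn (by simp) ρ hρ)
  obtain ⟨Z', hZ'⟩ := (hZ.1.differentiableOn (by simp) ρ hρ)
  have h1 := hasLineDerivAt_of_states hρ hv hL'
  have h2 := hasLineDerivAt_of_states hρ hv hZ'
  let B : Herm d →L[ℝ] Herm d →L[ℝ] ℝ := LinearMap.toContinuousLinearMap
    ((LinearMap.toContinuousLinearMap : (Herm d →ₗ[ℝ] ℝ) ≃ₗ[ℝ] _).toLinearMap ∘ₗ hs)
  have hB : ∀ a b, B a b = hs a b := fun _ _ => rfl
  have h3 : HasLineDerivAt ℝ (fun σ => B (Z σ) (G.eRep σ (Y σ)))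
      (B (Z ρ) (L' v) + B (Z' v) (G.eRep ρ (Y ρ))) ρ v := by
    have := (B.hasFDerivWithinAt_of_bilinear hZ' hL')
    have := hasLineDerivAt_of_states hρ hv this
    simpa using this
  have h4 : HasLineDerivAt ℝ (fun σ => G.metric σ (Y σ) (Z σ))
      (B (Z ρ) (L' v) + B (Z' v) (G.eRep ρ (Y ρ))) ρ v := by
    refine HasDerivAt.congr_of_eventuallyEq h3 ?_
    filter_upwards [eventually_mem_states hρ hv] with t ht
    rw [hB, ← G.metric_eq ht]
  rw [h4.lineDeriv, h1.lineDeriv, h2.lineDeriv, hB, hB, G.metric_eq hρ]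

theorem exists_metric_eq {ρ : Herm d} (hρ : ρ ∈ states d) (l : Herm d →ₗ[ℝ] ℝ) :
    ∃ w ∈ traceless d, ∀ z ∈ traceless d, G.metric ρ w z = l z := by
  let e : Herm d →ₗ[ℝ] Herm d :=
    { toFun := G.eRep ρ
      map_add' := fun X Y => by simpa using G.eRep_smul_add hρ 1 X Y
      map_smul' := fun c X => by
        have h0 : G.eRep ρ 0 = 0 := by
          simpa using G.eRep_smul_add hρ (-1) (0 : Herm d) 0
        simpa [h0] using G.eRep_smul_add hρ c X 0 }
  let g : traceless d →ₗ[ℝ] Module.Dual ℝ (traceless d) :=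
    LinearMap.mk₂ ℝ (fun x y => hs y.1 (e x.1)) (by simp) (by simp) (by simp) (by simp)
  have hg : Function.Injective g := by
    rw [injective_iff_map_eq_zero]
    intro x hx
    have h : hs x.1 (G.eRep ρ x.1) = 0 := congrArg (fun f : Module.Dual ℝ (traceless d) => f x) hx
    rw [← G.metric_eq hρ] at h
    exact Subtype.ext (G.metric_self_eq_zero hρ h)
  have hs' : Function.Surjective g :=
    (LinearMap.injective_iff_surjective_of_finrank_eq_finrank
      (Subspace.dual_finrank_eq (K := ℝ) (V := traceless d)).symm).1 hg
  obtain ⟨w, hw⟩ := hs' (l ∘ₗ (traceless d).subtype)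
  refine ⟨w.1, w.2, fun z hz => ?_⟩
  rw [G.metric_eq hρ]
  exact congrArg (fun f : Module.Dual ℝ (traceless d) => f ⟨z, hz⟩) hw

theorem metric_comm {ρ : Herm d} (hρ : ρ ∈ states d) (X Y : Herm d) :
    G.metric ρ X Y = G.metric ρ Y X := G.symm ρ hρ _ _

theorem metric_smul_add {ρ : Herm d} (hρ : ρ ∈ states d) (c : ℝ) (X X' Y : Herm d) :
    G.metric ρ (c • X + X') Y = c * G.metric ρ X Y + G.metric ρ X' Y := by
  simp [metric, G.eRep_smul_add hρ]

theorem metric_zero_right {ρ : Herm d} (hρ : ρ ∈ states d) (X : Herm d) :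
    G.metric ρ X 0 = 0 := by
  simp [G.metric_eq hρ]

theorem eq_of_metric_eq {ρ : Herm d} (hρ : ρ ∈ states d) {w w' : Herm d} (hw : w ∈ traceless d)
    (hw' : w' ∈ traceless d) (h : ∀ z ∈ traceless d, G.metric ρ w z = G.metric ρ w' z) :
    w = w' := by
  have hd : (-1 : ℝ) • w' + w ∈ traceless d :=
    Submodule.add_mem _ (Submodule.smul_mem _ _ hw') hw
  have := G.metric_self_eq_zero hρ (X := (-1 : ℝ) • w' + w) (by
    rw [G.metric_smul_add hρ, h _ hd]
    ring)
  rw [neg_one_smul, neg_add_eq_zero] at this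
  exact this.symm

/-- The e-connection is well defined. -/
theorem existsUnique_eNabla {X Y : Herm d → Herm d} (hX : IsVectorField X) (hY : IsVectorField Y)
    {ρ : Herm d} (hρ : ρ ∈ states d) : ∃! w, G.IsENablaAt X Y ρ w := by
  obtain ⟨w, hw, hwz⟩ := G.exists_metric_eq hρ
    (hs.flip (lineDeriv ℝ (fun σ => G.eRep σ (Y σ)) ρ (X ρ)))
  have hw0 : G.IsENablaAt X Y ρ w := by
    refine ⟨hw, fun Z hZ => ?_⟩
    rw [G.lineDeriv_metric hY hZ hρ (hX.2 ρ hρ), hwz _ (hZ.2 ρ hρ)]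
    rfl
  refine ⟨w, hw0, fun w' hw' => G.eq_of_metric_eq hρ hw'.1 hw fun z hz => ?_⟩
  have h1 := hw0.2 _ (isVectorField_const hz)
  have h2 := hw'.2 _ (isVectorField_const hz)
  linarith

theorem eNabla_spec {X Y : Herm d → Herm d} (hX : IsVectorField X) (hY : IsVectorField Y)
    {ρ : Herm d} (hρ : ρ ∈ states d) : G.IsENablaAt X Y ρ (G.eNabla X Y ρ) :=
  Classical.epsilon_spec (G.existsUnique_eNabla hX hY hρ).exists

theorem lineDeriv_mem_traceless {Y : Herm d → Herm d} (hY : IsVectorField Y)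
    {ρ v : Herm d} (hρ : ρ ∈ states d) (hv : v ∈ traceless d) :
    lineDeriv ℝ Y ρ v ∈ traceless d := by
  obtain ⟨Y', hY'⟩ := hY.1.differentiableOn (by simp) ρ hρ
  have h1 := hasLineDerivAt_of_states hρ hv hY'
  rw [h1.lineDeriv, mem_traceless]
  have h2 : HasDerivAt (fun t : ℝ => hs idOp (Y (ρ + t • v))) (hs idOp (Y' v)) 0 := by
    have h3 : HasDerivAt (fun t : ℝ => Y (ρ + t • v)) (Y' v) 0 := h1
    exact (LinearMap.toContinuousLinearMap (hs (idOp (d := d)))).hasFDerivAt.comp_hasDerivAt 0 h3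
  refine h2.unique (HasDerivAt.congr_of_eventuallyEq (hasDerivAt_const 0 (0 : ℝ)) ?_)
  filter_upwards [eventually_mem_states hρ hv] with t ht
  exact hY.2 _ ht

/-- Leibniz rule for the e-connection relative to a frame of constant vector fields. -/
theorem eNabla_eq_add {X Y : Herm d → Herm d} (hX : IsVectorField X) (hY : IsVectorField Y)
    {ρ : Herm d} (hρ : ρ ∈ states d) :
    G.eNabla X Y ρ = lineDeriv ℝ Y ρ (X ρ) + G.eNabla (fun _ => X ρ) (fun _ => Y ρ) ρ := by
  have hXρ := hX.2 ρ hρ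
  have hYρ := hY.2 ρ hρ
  have hs1 := G.eNabla_spec hX hY hρ
  have hs2 := G.eNabla_spec (isVectorField_const hXρ) (isVectorField_const hYρ) hρ
  have hD := lineDeriv_mem_traceless hY hρ hXρ
  refine G.eq_of_metric_eq hρ hs1.1 (Submodule.add_mem _ hD hs2.1) fun z hz => ?_
  have swap : ∀ Y' : Herm d → Herm d, lineDeriv ℝ (fun σ => G.metric σ (Y' σ) z) ρ (X ρ)
      = lineDeriv ℝ (fun σ => G.metric σ z (Y' σ)) ρ (X ρ) := fun Y' => by
    apply Filter.EventuallyEq.deriv_eq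
    filter_upwards [eventually_mem_states hρ hXρ] with t ht
    exact G.metric_comm ht _ _
  have hz' := isVectorField_const hz
  have h1 := hs1.2 _ hz'
  have h2 := hs2.2 _ hz'
  have h3 := G.lineDeriv_metric hz' hY hρ hXρ
  have h4 := G.lineDeriv_metric hz' (isVectorField_const hYρ) hρ hXρ
  rw [swap Y] at h1
  rw [swap (fun _ => Y ρ)] at h2
  have hc : ∀ c : Herm d, lineDeriv ℝ (fun _ : Herm d => c) ρ (X ρ) = 0 := fun c => by
    simp [lineDeriv]
  simp only [mNabla, hc, G.metric_zero_right hρ] at h1 h2 h4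
  have h5 := G.metric_smul_add hρ 1 (lineDeriv ℝ Y ρ (X ρ))
    (G.eNabla (fun _ => X ρ) (fun _ => Y ρ) ρ) z
  rw [one_smul, one_mul, G.metric_comm hρ (lineDeriv ℝ Y ρ (X ρ))] at h5
  linarith

end InnerProductFamily

namespace Model
variable {m : ℕ} (M : Model d m)

theorem push_mem_traceless (x : (Fin m → ℝ) → (Fin m → ℝ)) {ξ : Fin m → ℝ} (hξ : ξ ∈ M.dom) :
    M.push x ξ ∈ traceless d := by
  have hd : HasFDerivAt M.param (fderiv ℝ M.param ξ) ξ :=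
    ((M.smooth.contDiffAt (M.isOpen_dom.mem_nhds hξ)).differentiableAt (by simp)).hasFDerivAt
  have h := (LinearMap.toContinuousLinearMap (hs (idOp (d := d)))).hasFDerivAt.comp ξ hd
  have h0 : HasFDerivAt (fun η => hs idOp (M.param η)) (0 : (Fin m → ℝ) →L[ℝ] ℝ) ξ := by
    refine HasFDerivAt.congr_of_eventuallyEq (hasFDerivAt_const (1 : ℝ) ξ) ?_
    filter_upwards [M.isOpen_dom.mem_nhds hξ] with η hη
    rw [hs_idOp, (M.mem_states η hη).2]
    simp
  exact congrArg (fun f : (Fin m → ℝ) →L[ℝ] ℝ => f (x ξ)) (h.unique h0)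

/-- On restrictions to `M` of vector fields `Y` on `𝒮`, the induced connection is the e-connection
of `𝒮`. -/
theorem eNablaAlong_comp (G : InnerProductFamily d) (x : (Fin m → ℝ) → (Fin m → ℝ))
    {Y : Herm d → Herm d} (hY : IsVectorField Y) {ξ : Fin m → ℝ} (hξ : ξ ∈ M.dom) :
    M.eNablaAlong G x (fun η => Y (M.param η)) ξ = G.eNabla (fun _ => M.push x ξ) Y (M.param ξ) := by
  have hρ := M.mem_states ξ hξ
  have hx := M.push_mem_traceless x hξ
  rw [G.eNabla_eq_add (InnerProductFamily.isVectorField_const hx) hY hρ, eNablaAlong]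
  congr 1
  have hd : HasFDerivAt M.param (fderiv ℝ M.param ξ) ξ :=
    ((M.smooth.contDiffAt (M.isOpen_dom.mem_nhds hξ)).differentiableAt (by simp)).hasFDerivAt
  obtain ⟨Y', hY'⟩ := hY.1.differentiableOn (by simp) _ hρ
  rw [(hasLineDerivAt_of_states hρ hx hY').lineDeriv]
  have := (hY'.comp ξ hd.hasFDerivWithinAt M.mem_states).hasFDerivAt (M.isOpen_dom.mem_nhds hξ)
  have h2 := this.fderiv
  exact congrArg (fun f : (Fin m → ℝ) →L[ℝ] Herm d => f (x ξ)) h2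

end Model

/-! ### Tensor powers

`(ℂ^d)^{⊗n}` is `ℂ^(Fin n → d)`, with the tensor products of basis vectors as its basis. -/

/-- The tensor product `A_1 ⊗ ⋯ ⊗ A_n` of matrices. -/
def piKron {n : ℕ} (A : Fin n → Matrix d d ℂ) : Matrix (Fin n → d) (Fin n → d) ℂ :=
  Matrix.of fun x y => ∏ t, A t (x t) (y t)

theorem piKron_conjTranspose {n : ℕ} (A : Fin n → Matrix d d ℂ) :
    (piKron A)ᴴ = piKron (fun t => (A t)ᴴ) := by
  ext x y
  simp [piKron, Matrix.conjTranspose_apply]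

/-- The tensor product `A_1 ⊗ ⋯ ⊗ A_n` of Hermitian operators. -/
def tensor {n : ℕ} (A : Fin n → Herm d) : Herm (Fin n → d) :=
  Herm.mk (piKron fun t => (A t).mat) (by
    rw [Matrix.IsHermitian, piKron_conjTranspose]
    congr 1
    exact funext fun t => (A t).isHermitian_mat)

/-- The tensor power `ρ^{⊗n}`. -/
def tensorPow (n : ℕ) (ρ : Herm d) : Herm (Fin n → d) := tensor fun _ => ρ

theorem trace_piKron {n : ℕ} (A : Fin n → Matrix d d ℂ) :
    (piKron A).trace = ∏ t, (A t).trace := by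
  simp only [Matrix.trace, Matrix.diag, piKron, Matrix.of_apply]
  rw [Finset.prod_univ_sum, Fintype.piFinset_univ]

theorem piKron_mul {n : ℕ} (A B : Fin n → Matrix d d ℂ) :
    piKron A * piKron B = piKron fun t => A t * B t := by
  ext x y
  simp only [Matrix.mul_apply, piKron, Matrix.of_apply]
  rw [Finset.prod_univ_sum, Fintype.piFinset_univ]
  simp [Finset.prod_mul_distrib]

theorem piKron_one {n : ℕ} : piKron (fun _ : Fin n => (1 : Matrix d d ℂ)) = 1 := by
  ext x y
  simp only [piKron, Matrix.of_apply, Matrix.one_apply]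
  by_cases h : x = y
  · simp [h]
  · obtain ⟨t, ht⟩ := Function.ne_iff.1 h
    rw [if_neg h]
    exact Finset.prod_eq_zero (Finset.mem_univ t) (by simp [ht])

theorem trace_im (A B : Herm d) : (Matrix.trace (A.mat * B.mat)).im = 0 := by
  have hA : (A.mat)ᴴ = A.mat := A.2
  have hB : (B.mat)ᴴ = B.mat := B.2
  have h := Matrix.trace_conjTranspose (A.mat * B.mat)
  rw [Matrix.conjTranspose_mul, hA, hB, Matrix.trace_mul_comm] at h
  exact Complex.conj_eq_iff_im.1 h.symm

theorem trace_eq_hs (A B : Herm d) : Matrix.trace (A.mat * B.mat) = (hs A B : ℂ) := by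
  apply Complex.ext
  · rfl
  · simpa using trace_im A B

theorem hs_tensor {n : ℕ} (A B : Fin n → Herm d) :
    hs (tensor A) (tensor B) = ∏ t, hs (A t) (B t) := by
  rw [hs_apply]
  have : ((tensor A).mat * (tensor B).mat).trace = ((∏ t, hs (A t) (B t) : ℝ) : ℂ) := by
    change (piKron (fun t => (A t).mat) * piKron (fun t => (B t).mat)).trace = _
    rw [piKron_mul, trace_piKron]
    simp [trace_eq_hs]
  rw [this, Complex.ofReal_re]

open scoped MatrixOrder Matrix.Norms.L2Operator in
theorem posDef_piKron {n : ℕ} {A : Fin n → Matrix d d ℂ} (hA : ∀ t, (A t).PosDef) :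
    (piKron A).PosDef := by
  have h : ∀ t, ∃ b : Matrix d d ℂ, A t = star b * b := fun t =>
    CStarAlgebra.nonneg_iff_eq_star_mul_self.mp (hA t).posSemidef.nonneg
  choose b hb using h
  have hs : (piKron A).PosSemidef := by
    have : piKron A = (piKron b)ᴴ * piKron b := by
      rw [piKron_conjTranspose, piKron_mul]
      congr 1
      exact funext hb
    rw [this]
    exact Matrix.posSemidef_conjTranspose_mul_self _
  refine hs.posDef_iff_isUnit.2 ?_
  refine IsUnit.of_mul_eq_one (piKron fun t => (A t)⁻¹) ?_
  rw [piKron_mul, ← piKron_one]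
  congr 1
  funext t
  exact Matrix.mul_nonsing_inv _ ((Matrix.isUnit_iff_isUnit_det _).1 (hA t).isUnit)

theorem tensorPow_mem_states (n : ℕ) {ρ : Herm d} (hρ : ρ ∈ states d) :
    tensorPow n ρ ∈ states (Fin n → d) := by
  refine ⟨posDef_piKron fun _ => hρ.1, ?_⟩
  change (piKron fun _ : Fin n => ρ.mat).trace = 1
  rw [trace_piKron]
  simp [hρ.2]

theorem contDiff_tensorPow (n : ℕ) : ContDiff ℝ ∞ (tensorPow (d := d) n) := by
  let l : Herm (Fin n → d) →ₗ[ℝ] ((Fin n → d) → (Fin n → d) → ℂ) :=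
    { toFun := fun A x y => A.mat x y
      map_add' := fun _ _ => rfl
      map_smul' := fun _ _ => rfl }
  obtain ⟨r, hr⟩ := l.exists_leftInverse_of_injective (LinearMap.ker_eq_bot.2 fun A B h => by
    ext x y
    exact congrFun (congrFun h x) y)
  have h1 : tensorPow (d := d) n
      = fun ρ => LinearMap.toContinuousLinearMap r (fun x y => ∏ t, ρ.mat (x t) (y t)) := by
    funext ρ
    exact (LinearMap.congr_fun hr (tensorPow n ρ)).symm
  have h2 : ∀ i j, ContDiff ℝ ∞ (fun ρ : Herm d => ρ.mat i j) := fun i j =>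
    (LinearMap.toContinuousLinearMap
      ({ toFun := fun A => A.mat i j
         map_add' := fun _ _ => rfl
         map_smul' := fun _ _ => rfl } : Herm d →ₗ[ℝ] ℂ)).contDiff
  rw [h1]
  refine (LinearMap.toContinuousLinearMap r).contDiff.comp ?_
  refine contDiff_pi.2 fun x => contDiff_pi.2 fun y => ?_
  exact contDiff_prod fun t _ => h2 _ _

/-- `Tr (ρ^{⊗n} (A ⊗ I ⊗ ⋯ ⊗ I)) = Tr (ρ A)`. -/
theorem hs_tensorPow {n : ℕ} (t : Fin n) {ρ : Herm d} (hρ : ρ ∈ states d) (A : Herm d) :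
    hs (tensorPow n ρ) (tensor (Function.update (fun _ => idOp) t A)) = hs ρ A := by
  rw [tensorPow, hs_tensor, ← Finset.mul_prod_erase _ _ (Finset.mem_univ t), Function.update_self,
    Finset.prod_eq_one, mul_one]
  intro s hs'
  rw [Function.update_of_ne (Finset.ne_of_mem_erase hs'), hs_apply]
  simp [hρ.2]

theorem eq_of_hs_eq {A B : Herm d} (h : ∀ C, hs A C = hs B C) : A = B := by
  rw [← sub_eq_zero]
  apply eq_zero_of_hs_self
  simp [h]

/-- The `n`-fold i.i.d. extension `{ρ^{⊗n} | ρ ∈ M}` of a model, with the coordinates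
`ξ̃ (ρ^{⊗n}) = ξ (ρ)`. -/
def Model.iidExtension {m : ℕ} (M : Model d m) (n : ℕ) (hn : 2 ≤ n) : Model (Fin n → d) m where
  dom := M.dom
  isOpen_dom := M.isOpen_dom
  param := fun ξ => tensorPow n (M.param ξ)
  smooth := (contDiff_tensorPow n).comp_contDiffOn M.smooth
  mem_states := fun ξ hξ => tensorPow_mem_states n (M.mem_states ξ hξ)
  injOn := fun ξ hξ η hη h => by
    refine M.injOn hξ hη (eq_of_hs_eq fun C => ?_)
    rw [← hs_tensorPow (⟨0, by omega⟩ : Fin n) (M.mem_states ξ hξ),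
      ← hs_tensorPow (⟨0, by omega⟩ : Fin n) (M.mem_states η hη)]
    exact congrArg (fun T => hs T _) h
  immersion := fun ξ hξ => by
    rw [injective_iff_map_eq_zero]
    intro v hv
    apply (injective_iff_map_eq_zero _).1 (M.immersion ξ hξ)
    apply eq_of_hs_eq
    intro C
    have hM : HasFDerivAt M.param (fderiv ℝ M.param ξ) ξ :=
      ((M.smooth.contDiffAt (M.isOpen_dom.mem_nhds hξ)).differentiableAt (by simp)).hasFDerivAt
    have hT : HasFDerivAt (fun ξ => tensorPow n (M.param ξ))
        (fderiv ℝ (fun ξ => tensorPow n (M.param ξ)) ξ) ξ :=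
      (((contDiff_tensorPow n).differentiable (by simp) _).comp ξ hM.differentiableAt).hasFDerivAt
    let C' := tensor (Function.update (fun _ => idOp) (⟨0, by omega⟩ : Fin n) C)
    have h1 := (LinearMap.toContinuousLinearMap (hs.flip C)).hasFDerivAt.comp ξ hM
    have h2 := (LinearMap.toContinuousLinearMap (hs.flip C')).hasFDerivAt.comp ξ hT
    have h3 := h2.congr_of_eventuallyEq (f₁ := fun η => hs (M.param η) C) (by
      filter_upwards [M.isOpen_dom.mem_nhds hξ] with η hη
      exact (hs_tensorPow _ (M.mem_states η hη) C).symm)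
    have h4 := congrArg (fun f : (Fin m → ℝ) →L[ℝ] ℝ => f v) (h1.unique h3)
    have h5 : hs (fderiv ℝ M.param ξ v) C
        = hs (fderiv ℝ (fun ξ => tensorPow n (M.param ξ)) ξ v) C' := h4
    rw [h5, hv]
    simp

/-! ### Conditions relating the structures on `𝒮(H)` and on `𝒮(H^{⊗n})` -/

/-- The inner products are tensor-multiplicative:
`⟨⊗ A_t, ⊗ B_t⟩_{ρ^{⊗n}} = ∏ ⟨A_t, B_t⟩_ρ` for all Hermitian `A_t`, `B_t`. -/
def TensorMultiplicative {n : ℕ} (G : InnerProductFamily d)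
    (G' : InnerProductFamily (Fin n → d)) : Prop :=
  ∀ ρ ∈ states d, ∀ A B : Fin n → Herm d,
    G'.form (tensorPow n ρ) (tensor A) (tensor B) = ∏ t, G.form ρ (A t) (B t)

/-- Tensor-multiplicativity restricted to the case that at most one of the `A_t` differs from the
identity. -/
def OneSiteMultiplicative {n : ℕ} (G : InnerProductFamily d)
    (G' : InnerProductFamily (Fin n → d)) : Prop :=
  ∀ ρ ∈ states d, ∀ A B : Fin n → Herm d, (∃ t, ∀ s, s ≠ t → A s = idOp) →
    G'.form (tensorPow n ρ) (tensor A) (tensor B) = ∏ t, G.form ρ (A t) (B t)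

/-- `⟨A, B⟩_ρ = Tr (A f(Δ_ρ)(B) ρ)`, where `Δ_ρ (V) = ρ V ρ⁻¹` is the modular operator. The
super-operator `Δ_ρ` is diagonalizable with positive eigenvalues, and `f(Δ_ρ)` is the linear map `F`
that acts as multiplication by `f c` on the eigenspace of `Δ_ρ` to the eigenvalue `c`. -/
def IsInducedBy (f : ℝ → ℝ) (G : InnerProductFamily d) : Prop :=
  ∀ ρ ∈ states d, ∃ F : Matrix d d ℂ →ₗ[ℂ] Matrix d d ℂ,
    (∀ (c : ℝ) (V : Matrix d d ℂ), ρ.mat * V * ρ.mat⁻¹ = (c : ℂ) • V → F V = (f c : ℂ) • V) ∧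
    ∀ A B : Herm d, (G.form ρ A B : ℂ) = Matrix.trace (A.mat * (F B.mat * ρ.mat))

/-- The symmetrized inner product `⟨A, B⟩_ρ = Re Tr (ρ A B)`, inducing the SLD structure. -/
def sld (d : Type*) [Fintype d] [DecidableEq d] : InnerProductFamily d where
  form ρ := LinearMap.mk₂ ℝ (fun A B => (Matrix.trace (ρ.mat * A.mat * B.mat)).re)
    (fun A A' B => by simp [mul_add, add_mul])
    (fun c A B => by simp)
    (fun A B B' => by simp [mul_add])
    (fun c A B => by simp)
  symm ρ hρ A B := by
    change (Matrix.trace (ρ.mat * A.mat * B.mat)).re = (Matrix.trace (ρ.mat * B.mat * A.mat)).re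
    have h := Matrix.trace_conjTranspose (ρ.mat * A.mat * B.mat)
    rw [Matrix.conjTranspose_mul, Matrix.conjTranspose_mul, ρ.isHermitian_mat.eq,
      A.isHermitian_mat.eq, B.isHermitian_mat.eq, ← Matrix.mul_assoc, Matrix.trace_mul_comm,
      ← Matrix.mul_assoc] at h
    rw [h]
    simp
  pos ρ hρ A hA := by
    change 0 < (Matrix.trace (ρ.mat * A.mat * A.mat)).re
    have h1 : (A.mat * ρ.mat * A.mat).PosSemidef := by
      have := hρ.1.posSemidef.conjTranspose_mul_mul_same A.mat
      rwa [A.isHermitian_mat.eq] at this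
    have h2 : Matrix.trace (ρ.mat * A.mat * A.mat) = Matrix.trace (A.mat * ρ.mat * A.mat) := by
      rw [Matrix.trace_mul_comm, Matrix.mul_assoc]
    rw [h2]
    have h3 := h1.trace_nonneg
    have h4 : Matrix.trace (A.mat * ρ.mat * A.mat) ≠ 0 := by
      rw [Ne, h1.trace_eq_zero_iff]
      intro h0
      apply hA
      ext1
      rw [Matrix.ext_iff_mulVec]
      intro x
      rw [Herm.mat_zero, Matrix.zero_mulVec]
      by_contra hx
      have h6 := hρ.1.re_dotProduct_pos (x := A.mat *ᵥ x) hx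
      have h7 : star (A.mat *ᵥ x) ⬝ᵥ (ρ.mat *ᵥ (A.mat *ᵥ x))
          = star x ⬝ᵥ ((A.mat * ρ.mat * A.mat) *ᵥ x) := by
        rw [Matrix.star_mulVec, A.isHermitian_mat.eq, ← Matrix.dotProduct_mulVec,
          Matrix.mulVec_mulVec, Matrix.mulVec_mulVec, Matrix.mul_assoc]
      rw [h7, h0] at h6
      simp at h6
    have h5 := lt_of_le_of_ne h3 (Ne.symm h4)
    exact (Complex.lt_def.1 h5).1
  smooth A B := by
    let l : Herm d →ₗ[ℝ] ℝ :=
      { toFun := fun ρ => (Matrix.trace (ρ.mat * A.mat * B.mat)).re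
        map_add' := fun ρ σ => by simp [add_mul]
        map_smul' := fun c ρ => by simp }
    exact (LinearMap.toContinuousLinearMap l).contDiff.contDiffOn
  unit ρ hρ A := by
    change (Matrix.trace (ρ.mat * A.mat * 1)).re = _
    rw [mul_one, hs_apply]

end QStat

end

open scoped ContDiff Matrix ComplexOrder

noncomputable section

namespace QStat
variable {d : Type*} [Fintype d] [DecidableEq d]

/-! ### Tensor products span -/

/-! Write `L_Y` for the e-representation of `Y`. Since the m-connection is flat, its dual
differentiates e-representations: `g(∇_X Y, Z) = Tr (Z · X(L_Y))`, where only `X(L_Y)` modulo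
multiples of `I` matters because `Z` is traceless (`Model.eNablaAlong_spec`). Inverting the Gram
matrix gives fields `a_k` on `M` with `Tr (∂_j ρ · L_k) = δ_jk`, where `L_k` is the e-representation
of `a_k` (`Model.exists_isDualFrame`). Differentiating this relation gives `Tr (X(∂_j ρ) L_k) = -Tr
(∂_j ρ · X(L_k))`. For m-affine coordinates the left side vanishes, and autoparallelity says that
`X(L_k)` is, modulo `I`, the e-representation of a vector tangent to `M`; being orthogonal to all
`∂_j`, that vector is zero. Conversely, constancy of the `L_k` modulo `I` yields both properties. So
the two properties together mean that all derivatives of the `L_k` are scalar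
(`Model.IsDualFrame.autoparallel_affine_iff`).

One-site multiplicativity makes the e-representation of a derivative of `ρ^{⊗n}` the sum over all
sites of copies of the e-representation of the derivative of `ρ` (`Model.eRep_iidExtension`); it
suffices to test this on product operators, which span. Hence the dual frame of the extension is
`a_k / n`, represented by the average of the copies of `L_k`. A sum of copies is scalar exactly when
the summand is (`sum_site_eq_smul_idOp_iff`), so the criterion holds for `M` if and only if it holds
for the extension.

For inner products given by `f`, an eigenvector of the modular operator of `ρ` placed at one site is
an eigenvector for `ρ^{⊗n}` with the same eigenvalue, so `f` of the modular operator commutes with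
the placement. For the SLD inner product, the traces at the remaining sites are real, so the real
part passes through the product. -/

/-- The tensor product of matrices as a multilinear map. -/
def piKronMultilinear (d : Type*) [Fintype d] [DecidableEq d] (n : ℕ) :
    MultilinearMap ℂ (fun _ : Fin n => Matrix d d ℂ) (Matrix (Fin n → d) (Fin n → d) ℂ) where
  toFun := piKron
  map_update_add' A t V W := by
    ext x y
    -- Each entry is a product of one scalar per factor, hence multilinear as multiplication
    -- composed with the entry functionals.
    exact ((MultilinearMap.mkPiAlgebra ℂ (Fin n) ℂ).compLinearMap
      fun s => Matrix.entryLinearMap ℂ ℂ (x s) (y s)).map_update_add A t V W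
  map_update_smul' A t c V := by
    ext x y
    exact ((MultilinearMap.mkPiAlgebra ℂ (Fin n) ℂ).compLinearMap
      fun s => Matrix.entryLinearMap ℂ ℂ (x s) (y s)).map_update_smul A t c V

theorem piKron_update_add {n : ℕ} (A : Fin n → Matrix d d ℂ) (t : Fin n) (V W : Matrix d d ℂ) :
    piKron (Function.update A t (V + W))
      = piKron (Function.update A t V) + piKron (Function.update A t W) :=
  (piKronMultilinear d n).map_update_add A t V W

theorem piKron_update_smul {n : ℕ} (A : Fin n → Matrix d d ℂ) (t : Fin n) (c : ℂ)
    (V : Matrix d d ℂ) :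
    piKron (Function.update A t (c • V)) = c • piKron (Function.update A t V) :=
  (piKronMultilinear d n).map_update_smul A t c V

/-- `S` contains the sites whose factor may fail to be Hermitian. They are removed one at a time by
splitting the factor into real and imaginary parts and using multilinearity. -/
theorem piKron_mem_span_tensor {n : ℕ} (S : Finset (Fin n)) (B : Fin n → Matrix d d ℂ)
    (hB : ∀ t ∉ S, (B t).IsHermitian) :
    piKron B ∈ Submodule.span ℂ (Set.range fun A : Fin n → Herm d => (tensor A).mat) := by
  induction S using Finset.induction_on generalizing B with
  | empty => exact Submodule.subset_span ⟨fun t => Herm.mk (B t) (hB t (by simp)), rfl⟩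
  | insert a S ha ih =>
    have key : ∀ V : Matrix d d ℂ, V.IsHermitian → piKron (Function.update B a V)
        ∈ Submodule.span ℂ (Set.range fun A : Fin n → Herm d => (tensor A).mat) := by
      intro V hV
      refine ih _ fun t ht => ?_
      by_cases h : t = a
      · subst h
        simpa using hV
      · rw [Function.update_of_ne h]
        exact hB t (by simp [h, ht])
    rw [← Function.update_eq_self a B, ← realPart_add_I_smul_imaginaryPart (B a),
      piKron_update_add, piKron_update_smul]
    exact Submodule.add_mem _ (key _ (realPart (B a)).2)
      (Submodule.smul_mem _ _ (key _ (imaginaryPart (B a)).2))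

theorem piKron_single {n : ℕ} (x y : Fin n → d) :
    piKron (fun t => Matrix.single (x t) (y t) (1 : ℂ)) = Matrix.single x y 1 := by
  ext u v
  simp only [piKron, Matrix.of_apply, Matrix.single_apply]
  by_cases h : x = u ∧ y = v
  · obtain ⟨rfl, rfl⟩ := h
    simp
  · rw [if_neg h]
    rw [not_and_or, ← ne_eq, ← ne_eq, Function.ne_iff, Function.ne_iff] at h
    rcases h with ⟨t, ht⟩ | ⟨t, ht⟩ <;>
      exact Finset.prod_eq_zero (Finset.mem_univ t) (by simp [ht])

/-- Every matrix is a combination of matrix units, and these are tensor products of matrix units. -/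
theorem mem_span_tensor_mat {n : ℕ} (C : Matrix (Fin n → d) (Fin n → d) ℂ) :
    C ∈ Submodule.span ℂ (Set.range fun A : Fin n → Herm d => (tensor A).mat) := by
  rw [Matrix.matrix_eq_sum_single C]
  refine Submodule.sum_mem _ fun x _ => Submodule.sum_mem _ fun y _ => ?_
  have : Matrix.single x y (C x y) = C x y • Matrix.single x y (1 : ℂ) := by simp
  rw [this, ← piKron_single]
  exact Submodule.smul_mem _ _ (piKron_mem_span_tensor Finset.univ _ (by simp))

/-- The Hermitian part of a matrix. -/
def hermPart (d : Type*) [Fintype d] [DecidableEq d] : Matrix d d ℂ →ₗ[ℝ] Herm d :=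
  realPart

theorem hermPart_smul_mat (z : ℂ) (A : Herm d) : hermPart d (z • A.mat) = z.re • A := by
  have h1 : realPart A.mat = A := Subtype.ext (IsSelfAdjoint.coe_realPart A.2)
  have h2 : imaginaryPart A.mat = 0 := IsSelfAdjoint.imaginaryPart A.2
  change realPart (z • A.mat) = z.re • A
  rw [realPart_smul, h1, h2, smul_zero, sub_zero]
  rfl

/-- Taking Hermitian parts in a complex combination of Hermitian tensors replaces the coefficients
by their real parts. -/
theorem span_tensor (n : ℕ) :
    Submodule.span ℝ (Set.range fun A : Fin n → Herm d => tensor A) = ⊤ := by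
  refine Submodule.eq_top_iff'.2 fun C => ?_
  -- The factor `z` is needed in the induction because the Hermitian part is only real-linear.
  have key : ∀ D ∈ Submodule.span ℂ (Set.range fun A : Fin n → Herm d => (tensor A).mat),
      ∀ z : ℂ, hermPart _ (z • D) ∈ Submodule.span ℝ (Set.range fun A : Fin n → Herm d => tensor A) := by
    intro D hD
    induction hD using Submodule.span_induction with
    | mem D hD =>
      obtain ⟨A, rfl⟩ := hD
      intro z
      rw [hermPart_smul_mat]
      exact Submodule.smul_mem _ _ (Submodule.subset_span ⟨A, rfl⟩)
    | zero => simp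
    | add D E _ _ h1 h2 =>
      intro z
      rw [smul_add, map_add]
      exact Submodule.add_mem _ (h1 z) (h2 z)
    | smul c D _ h =>
      intro z
      rw [smul_smul]
      exact h _
  have := key C.mat (mem_span_tensor_mat _) 1
  rwa [hermPart_smul_mat, Complex.one_re, one_smul] at this

theorem linearMap_ext_tensor {n : ℕ} {l l' : Herm (Fin n → d) →ₗ[ℝ] ℝ}
    (h : ∀ A : Fin n → Herm d, l (tensor A) = l' (tensor A)) : l = l' :=
  LinearMap.ext_on (span_tensor n) (by rintro _ ⟨A, rfl⟩; exact h A)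

/-! ### One-site operators and their expectations. -/

theorem mat_tensor_update_idOp {n : ℕ} (t : Fin n) (A : Herm d) :
    (tensor (Function.update (fun _ => idOp) t A)).mat
      = piKron (Function.update (fun _ => 1) t A.mat) := by
  change piKron _ = _
  congr 1
  funext s
  by_cases hs : s = t
  · subst hs; simp
  · simp [hs]

/-- The operator `I ⊗ ⋯ ⊗ A ⊗ ⋯ ⊗ I` with `A` at the site `t`. -/
def site {n : ℕ} (t : Fin n) : Herm d →ₗ[ℝ] Herm (Fin n → d) where
  toFun A := tensor (Function.update (fun _ => idOp) t A)
  map_add' A B := by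
    ext1
    simp only [Herm.mat_add, mat_tensor_update_idOp, piKron_update_add]
  map_smul' c A := by
    ext1
    have h : ∀ {e : Type _} (V : Matrix e e ℂ), c • V = (c : ℂ) • V := fun V => by
      ext; simp
    rw [RingHom.id_apply, Herm.mat_smul, mat_tensor_update_idOp, mat_tensor_update_idOp,
      Herm.mat_smul, h, h, piKron_update_smul]

theorem site_apply {n : ℕ} (t : Fin n) (A : Herm d) :
    site t A = tensor (Function.update (fun _ => idOp) t A) := rfl

theorem hs_state_idOp {ρ : Herm d} (hρ : ρ ∈ states d) : hs ρ idOp = 1 := by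
  rw [hs_comm, hs_idOp, hρ.2, Complex.one_re]

theorem site_idOp {n : ℕ} (t : Fin n) : site t (idOp : Herm d) = idOp := by
  ext1
  rw [site_apply, mat_tensor_update_idOp, mat_idOp, mat_idOp,
    show Function.update (fun _ : Fin n => (1 : Matrix d d ℂ)) t 1 = fun _ => 1 from
      Function.update_eq_self t _, piKron_one]

/-- The expectation of a one-site operator in a product operator. -/
theorem hs_tensor_site {n : ℕ} (t : Fin n) (B : Fin n → Herm d) (A : Herm d) :
    hs (tensor B) (site t A) = hs (B t) A * ∏ s ∈ Finset.univ.erase t, hs (B s) idOp := by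
  rw [site_apply, hs_tensor, ← Finset.mul_prod_erase _ _ (Finset.mem_univ t), Function.update_self]
  congr 1
  refine Finset.prod_congr rfl fun s hs' => ?_
  rw [Function.update_of_ne (Finset.ne_of_mem_erase hs')]

/-- Subtracting from `B` its projection onto `I` leaves a traceless operator orthogonal to itself.
-/
theorem exists_eq_smul_idOp {B : Herm d} (h : ∀ w ∈ traceless d, hs w B = 0) :
    ∃ c : ℝ, B = c • idOp := by
  -- This case covers the zero-dimensional space, where `Tr I = 0`.
  by_cases h1 : hs (idOp : Herm d) idOp = 0
  · have h0 := eq_zero_of_hs_self h1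
    refine ⟨0, ?_⟩
    rw [zero_smul]
    exact eq_zero_of_hs_self (h B (by rw [mem_traceless, h0]; simp))
  · refine ⟨hs idOp B / hs (idOp : Herm d) idOp, sub_eq_zero.1 (eq_zero_of_hs_self ?_)⟩
    set c := hs idOp B / hs (idOp : Herm d) idOp with hc
    have ht : hs idOp (B - c • idOp) = 0 := by
      rw [map_sub, map_smul, smul_eq_mul, hc, div_mul_cancel₀ _ h1, sub_self]
    rw [map_sub, map_smul, h _ ht, hs_comm _ idOp, ht]
    simp

/-- A sum of copies of `B` over all sites is scalar only if `B` is. -/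
theorem sum_site_eq_smul_idOp_iff {n : ℕ} (hn : n ≠ 0) {ρ : Herm d} (hρ : ρ ∈ states d)
    (B : Herm d) :
    (∃ c : ℝ, ∑ t : Fin n, site t B = c • idOp) ↔ ∃ c : ℝ, B = c • idOp := by
  constructor
  · rintro ⟨c, hc⟩
    refine exists_eq_smul_idOp fun w hw => ?_
    let t₀ : Fin n := ⟨0, Nat.pos_of_ne_zero hn⟩
    have hw0 : hs w idOp = 0 := by rw [hs_comm]; exact hw
    -- Pairing with `w` at the site `t₀` and `ρ` elsewhere isolates the copy at `t₀`: every other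
    -- copy leaves the factor `Tr w = 0`.
    have h1 : ∀ t A, hs (tensor (Function.update (fun _ => ρ) t₀ w)) (site t A)
        = if t = t₀ then hs w A else 0 := by
      intro t A
      rw [hs_tensor_site]
      split_ifs with h
      · subst h
        rw [Function.update_self, Finset.prod_eq_one, mul_one]
        intro s hs'
        rw [Function.update_of_ne (Finset.ne_of_mem_erase hs'), hs_state_idOp hρ]
      · rw [Finset.prod_eq_zero (i := t₀) (by simp [Ne.symm h]) (by simp [hw0]), mul_zero]
    have h2 := congrArg (hs (tensor (Function.update (fun _ => ρ) t₀ w))) hc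
    rw [map_sum] at h2
    simp only [h1, Finset.sum_ite_eq', Finset.mem_univ, if_true] at h2
    rw [h2, map_smul, ← site_idOp t₀, h1, if_pos rfl, hw0, smul_zero]
  · rintro ⟨c, rfl⟩
    exact ⟨n * c, by simp [site_idOp, ← mul_smul, ← Nat.cast_smul_eq_nsmul ℝ]⟩

/-! ### Calculus on a model -/

/-- The Hilbert-Schmidt form as a continuous bilinear map. -/
def hsL (d : Type*) [Fintype d] [DecidableEq d] : Herm d →L[ℝ] Herm d →L[ℝ] ℝ :=
  LinearMap.toContinuousLinearMap
    ((LinearMap.toContinuousLinearMap : (Herm d →ₗ[ℝ] ℝ) ≃ₗ[ℝ] _).toLinearMap ∘ₗ hs)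

theorem hsL_apply (A B : Herm d) : hsL d A B = hs A B := rfl

theorem contDiffOn_hs {E : Type*} [NormedAddCommGroup E] [NormedSpace ℝ E] {s : Set E}
    {A B : E → Herm d} (hA : ContDiffOn ℝ ∞ A s) (hB : ContDiffOn ℝ ∞ B s) :
    ContDiffOn ℝ ∞ (fun x => hs (A x) (B x)) s :=
  ((hsL d).contDiff.comp_contDiffOn hA).clm_apply hB

theorem fderiv_hs {E : Type*} [NormedAddCommGroup E] [NormedSpace ℝ E] {A B : E → Herm d} {x : E}
    (hA : DifferentiableAt ℝ A x) (hB : DifferentiableAt ℝ B x) (v : E) :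
    fderiv ℝ (fun y => hs (A y) (B y)) x v
      = hs (fderiv ℝ A x v) (B x) + hs (A x) (fderiv ℝ B x v) := by
  have h := ((hsL d).hasFDerivAt_of_bilinear hA.hasFDerivAt hB.hasFDerivAt).fderiv
  have h' := congrArg (fun f : E →L[ℝ] ℝ => f v) h
  simp only [hsL_apply] at h'
  rw [h']
  simp [hsL_apply, add_comm]

namespace InnerProductFamily
variable (G : InnerProductFamily d)

theorem eRep_zero {ρ : Herm d} (hρ : ρ ∈ states d) : G.eRep ρ 0 = 0 := by
  simpa using G.eRep_smul_add hρ (-1) (0 : Herm d) 0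

/-- The e-representation at a state as a linear map. -/
def eRepLinear {ρ : Herm d} (hρ : ρ ∈ states d) : Herm d →ₗ[ℝ] Herm d where
  toFun := G.eRep ρ
  map_add' X Y := by simpa using G.eRep_smul_add hρ 1 X Y
  map_smul' c X := by simpa [G.eRep_zero hρ] using G.eRep_smul_add hρ c X 0

theorem eRepLinear_apply {ρ : Herm d} (hρ : ρ ∈ states d) (X : Herm d) :
    G.eRepLinear hρ X = G.eRep ρ X := rfl

end InnerProductFamily

namespace Model
variable {m : ℕ} (M : Model d m) (G : InnerProductFamily d)

/-- The e-representation along `M` of a vector field on `M`. -/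
def eRepField (y : (Fin m → ℝ) → (Fin m → ℝ)) : (Fin m → ℝ) → Herm d :=
  fun ξ => G.eRep (M.param ξ) (M.push y ξ)

theorem differentiableAt_of_contDiffOn {F : Type*} [NormedAddCommGroup F] [NormedSpace ℝ F]
    {f : (Fin m → ℝ) → F} (hf : ContDiffOn ℝ ∞ f M.dom) {ξ : Fin m → ℝ} (hξ : ξ ∈ M.dom) :
    DifferentiableAt ℝ f ξ :=
  (hf.contDiffAt (M.isOpen_dom.mem_nhds hξ)).differentiableAt (by simp)

theorem contDiffOn_fderiv {F : Type*} [NormedAddCommGroup F] [NormedSpace ℝ F]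
    {f : (Fin m → ℝ) → F} (hf : ContDiffOn ℝ ∞ f M.dom) {x : (Fin m → ℝ) → (Fin m → ℝ)}
    (hx : M.IsField x) : ContDiffOn ℝ ∞ (fun ξ => fderiv ℝ f ξ (x ξ)) M.dom :=
  (hf.fderiv_of_isOpen M.isOpen_dom (by simp)).clm_apply hx

theorem contDiffOn_push {y : (Fin m → ℝ) → (Fin m → ℝ)} (hy : M.IsField y) :
    ContDiffOn ℝ ∞ (M.push y) M.dom := M.contDiffOn_fderiv M.smooth hy

theorem contDiffOn_eRepField {y : (Fin m → ℝ) → (Fin m → ℝ)} (hy : M.IsField y) :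
    ContDiffOn ℝ ∞ (M.eRepField G y) M.dom :=
  G.contDiffOn_eRep M.smooth M.mem_states (M.contDiffOn_push hy)

theorem isField_const (v : Fin m → ℝ) : M.IsField fun _ => v := contDiffOn_const

theorem fderiv_mem_traceless {Y : (Fin m → ℝ) → Herm d} (hY : ContDiffOn ℝ ∞ Y M.dom)
    (hY0 : ∀ ξ ∈ M.dom, Y ξ ∈ traceless d) {ξ : Fin m → ℝ} (hξ : ξ ∈ M.dom) (v : Fin m → ℝ) :
    fderiv ℝ Y ξ v ∈ traceless d := by
  have h := fderiv_hs (A := fun _ => (idOp : Herm d)) (differentiableAt_const _)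
    (M.differentiableAt_of_contDiffOn hY hξ) v
  have h0 : (fun η => hs idOp (Y η)) =ᶠ[nhds ξ] fun _ => 0 := by
    filter_upwards [M.isOpen_dom.mem_nhds hξ] with η hη
    exact hY0 η hη
  rw [h0.fderiv_eq] at h
  rw [mem_traceless]
  simpa using h.symm

/-- The e-connection along `M` differentiates e-representations, modulo the identity. -/
theorem eNablaAlong_spec (x : (Fin m → ℝ) → (Fin m → ℝ)) {Y : (Fin m → ℝ) → Herm d}
    (hY : ContDiffOn ℝ ∞ Y M.dom) (hY0 : ∀ ξ ∈ M.dom, Y ξ ∈ traceless d) {ξ : Fin m → ℝ}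
    (hξ : ξ ∈ M.dom) :
    M.eNablaAlong G x Y ξ ∈ traceless d ∧ ∀ z ∈ traceless d,
      G.metric (M.param ξ) (M.eNablaAlong G x Y ξ) z
        = hs z (fderiv ℝ (fun η => G.eRep (M.param η) (Y η)) ξ (x ξ)) := by
  have hρ := M.mem_states ξ hξ
  have hx := M.push_mem_traceless x hξ
  have hc := InnerProductFamily.isVectorField_const (hY0 ξ hξ)
  have hspec := G.eNabla_spec (InnerProductFamily.isVectorField_const hx) hc hρ
  refine ⟨Submodule.add_mem _ (M.fderiv_mem_traceless hY hY0 hξ _) hspec.1, fun z hz => ?_⟩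
  have h1 := hspec.2 _ (InnerProductFamily.isVectorField_const hz)
  rw [G.lineDeriv_metric hc (InnerProductFamily.isVectorField_const hz) hρ hx] at h1
  -- The two terms are the partial derivatives of the e-representation in the vector and in the base
  -- point; the rest of the proof recombines them by the chain rule.
  have h2 : G.metric (M.param ξ) (M.eNablaAlong G x Y ξ) z
      = G.metric (M.param ξ) (fderiv ℝ Y ξ (x ξ)) z
        + hs z (lineDeriv ℝ (fun σ => G.eRep σ (Y ξ)) (M.param ξ) (M.push x ξ)) := by
    rw [eNablaAlong, ← one_smul ℝ (fderiv ℝ Y ξ (x ξ)), G.metric_smul_add hρ, one_mul, one_smul]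
    simp only [mNabla] at h1
    linarith
  rw [h2, G.metric_eq hρ, ← map_add]
  congr 1
  have hE : ContDiffOn ℝ ∞ (fun p : Herm d × Herm d => G.eRep p.1 p.2) (states d ×ˢ Set.univ) :=
    G.contDiffOn_eRep contDiff_fst.contDiffOn (fun p hp => hp.1) contDiff_snd.contDiffOn
  -- The e-representation is controlled only over `𝒮`, so `E'` is a derivative within a set; it is
  -- used along maps that stay in that set.
  obtain ⟨E', hE'⟩ := hE.differentiableOn (by simp) (M.param ξ, Y ξ) ⟨hρ, Set.mem_univ _⟩
  have hM := (M.differentiableAt_of_contDiffOn M.smooth hξ).hasFDerivAt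
  have hYd := (M.differentiableAt_of_contDiffOn hY hξ).hasFDerivAt
  let e : Herm d × Herm d → Herm d := fun p => G.eRep p.1 p.2
  have h3 : HasFDerivAt (fun η => G.eRep (M.param η) (Y η))
      (E'.comp ((fderiv ℝ M.param ξ).prod (fderiv ℝ Y ξ))) ξ :=
    (HasFDerivWithinAt.comp (g := e) (f := fun η => (M.param η, Y η))
      (t := states d ×ˢ Set.univ) (s := M.dom) ξ hE'
      (hM.prodMk hYd).hasFDerivWithinAt
      fun η hη => ⟨M.mem_states η hη, Set.mem_univ _⟩).hasFDerivAt (M.isOpen_dom.mem_nhds hξ)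
  have h4 : HasFDerivWithinAt (fun σ => G.eRep σ (Y ξ))
      (E'.comp (ContinuousLinearMap.inl ℝ (Herm d) (Herm d))) (states d) (M.param ξ) :=
    HasFDerivWithinAt.comp (g := e) (f := fun σ => (σ, Y ξ))
      (t := states d ×ˢ Set.univ) (s := states d) (M.param ξ) hE'
      (hasFDerivAt_prodMk_left (M.param ξ) (Y ξ)).hasFDerivWithinAt
      fun σ hσ => ⟨hσ, Set.mem_univ _⟩
  have h5 : HasFDerivAt (fun B => G.eRep (M.param ξ) B)
      (E'.comp (ContinuousLinearMap.inr ℝ (Herm d) (Herm d))) (Y ξ) :=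
    (HasFDerivWithinAt.comp (g := e) (f := fun B => (M.param ξ, B))
      (t := states d ×ˢ Set.univ) (s := Set.univ) (Y ξ) hE'
      (hasFDerivAt_prodMk_right (M.param ξ) (Y ξ)).hasFDerivWithinAt
      fun B _ => ⟨hρ, Set.mem_univ _⟩).hasFDerivAt Filter.univ_mem
  -- For a fixed base point the e-representation is linear, so it is its own derivative.
  have h6 := h5.unique (LinearMap.toContinuousLinearMap (G.eRepLinear hρ)).hasFDerivAt
  have h7 : G.eRep (M.param ξ) (fderiv ℝ Y ξ (x ξ)) = E' (0, fderiv ℝ Y ξ (x ξ)) :=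
    (congrArg (fun f : Herm d →L[ℝ] Herm d => f (fderiv ℝ Y ξ (x ξ))) h6).symm
  rw [(hasLineDerivAt_of_states hρ hx h4).lineDeriv, h3.fderiv, h7]
  change E' _ + E' (M.push x ξ, 0) = E' (M.push x ξ, _)
  rw [← map_add]
  simp

/-- Apply the product rule to `g(Y, ∂_j) = Tr (∂_j ρ · L_Y)`: the term in which `L_Y` is
differentiated is the e-connection term and cancels. -/
theorem isMAffine_iff : M.IsMAffine G ↔ ∀ (j : Fin m) (v : Fin m → ℝ) (y), M.IsField y →
    ∀ ξ ∈ M.dom, hs (fderiv ℝ (M.push fun _ => Pi.single j 1) ξ v) (M.eRepField G y ξ) = 0 := by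
  have key : ∀ (j : Fin m) (x y : (Fin m → ℝ) → (Fin m → ℝ)), M.IsField y → ∀ ξ ∈ M.dom,
      (fderiv ℝ (fun η => G.metric (M.param η) (M.push y η) (M.push (fun _ => Pi.single j 1) η))
          ξ (x ξ)
        = G.metric (M.param ξ) (M.eNablaAlong G x (M.push y) ξ) (M.push (fun _ => Pi.single j 1) ξ)
          + G.metric (M.param ξ) (M.push y ξ) (M.push (fun _ => 0) ξ) ↔
      hs (fderiv ℝ (M.push fun _ => Pi.single j 1) ξ (x ξ)) (M.eRepField G y ξ) = 0) := by
    intro j x y hy ξ hξ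
    have h0 : M.push (fun _ => 0) ξ = 0 := by simp [push]
    have h1 : (fun η => G.metric (M.param η) (M.push y η) (M.push (fun _ => Pi.single j 1) η))
        =ᶠ[nhds ξ] fun η => hs (M.push (fun _ => Pi.single j 1) η) (M.eRepField G y η) := by
      filter_upwards [M.isOpen_dom.mem_nhds hξ] with η hη
      exact G.metric_eq (M.mem_states η hη) _ _
    rw [h0, G.metric_zero_right (M.mem_states ξ hξ), add_zero, h1.fderiv_eq,
      fderiv_hs (M.differentiableAt_of_contDiffOn (M.contDiffOn_push (M.isField_const _)) hξ)
        (M.differentiableAt_of_contDiffOn (M.contDiffOn_eRepField G hy) hξ),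
      (M.eNablaAlong_spec G x (M.contDiffOn_push hy) (fun η hη => M.push_mem_traceless y hη) hξ).2 _
        (M.push_mem_traceless _ hξ)]
    exact add_eq_right
  constructor
  · intro h j v y hy ξ hξ
    exact (key j (fun _ => v) y hy ξ hξ).1 (h j _ (M.isField_const v) y hy ξ hξ)
  · intro h j x _ y hy ξ hξ
    exact (key j x y hy ξ hξ).2 (h j (x ξ) y hy ξ hξ)

/-- Nondegeneracy of the induced metric: a tangent vector orthogonal to all `∂_j` has length zero,
and the parametrization is an immersion. -/
theorem eq_zero_of_hs_eRep_self {ξ : Fin m → ℝ} (hξ : ξ ∈ M.dom) {v : Fin m → ℝ}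
    (h : ∀ j, hs (fderiv ℝ M.param ξ (Pi.single j 1))
      (G.eRep (M.param ξ) (fderiv ℝ M.param ξ v)) = 0) : v = 0 := by
  have h1 : (hs.flip (G.eRep (M.param ξ) (fderiv ℝ M.param ξ v))) ∘ₗ
      (fderiv ℝ M.param ξ).toLinearMap = 0 := by
    refine LinearMap.pi_ext' fun j => LinearMap.ext_ring ?_
    simpa using h j
  have h2 := LinearMap.congr_fun h1 v
  have h3 := G.metric_self_eq_zero (M.mem_states ξ hξ)
    ((G.metric_eq (M.mem_states ξ hξ) _ _).trans h2)
  exact (injective_iff_map_eq_zero _).1 (M.immersion ξ hξ) v h3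

/-! ### Dual frames and the constancy criterion. -/

/-- Vector fields `a k` on `M` whose e-representations are dual to the coordinate vector fields. -/
def IsDualFrame (a : Fin m → (Fin m → ℝ) → (Fin m → ℝ)) : Prop :=
  (∀ k, M.IsField (a k)) ∧
    ∀ ξ ∈ M.dom, ∀ k v, hs (fderiv ℝ M.param ξ v) (M.eRepField G (a k) ξ) = v k

/-- The Gram matrix of the coordinate fields is invertible and smooth, and the columns of its
inverse are the required components. -/
theorem exists_isDualFrame : ∃ a, M.IsDualFrame G a := by
  let e : Fin m → (Fin m → ℝ) → (Fin m → ℝ) := fun j _ => Pi.single j 1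
  let g : (Fin m → ℝ) → Matrix (Fin m) (Fin m) ℝ := fun ξ =>
    Matrix.of fun j k => hs (M.push (e j) ξ) (M.eRepField G (e k) ξ)
  let T : (Fin m → ℝ) → ((Fin m → ℝ) →L[ℝ] (Fin m → ℝ)) := fun ξ =>
    LinearMap.toContinuousLinearMap (Matrix.toLin' (g ξ))
  have hTa : ∀ ξ v j, T ξ v j = ∑ k, hs (M.push (e j) ξ) (M.eRepField G (e k) ξ) * v k :=
    fun ξ v j => rfl
  have hTs : ContDiffOn ℝ ∞ T M.dom := by
    rw [contDiffOn_clm_apply]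
    intro v
    rw [contDiffOn_pi]
    intro j
    simp only [hTa]
    exact ContDiffOn.sum fun k _ => (contDiffOn_hs (M.contDiffOn_push (M.isField_const _))
      (M.contDiffOn_eRepField G (M.isField_const _))).mul contDiffOn_const
  have hTv : ∀ ξ ∈ M.dom, ∀ v j, T ξ v j
      = hs (M.push (e j) ξ) (G.eRep (M.param ξ) (fderiv ℝ M.param ξ v)) := by
    intro ξ hξ v j
    have : v = ∑ k, v k • (Pi.single k 1 : Fin m → ℝ) := by
      simp [← Pi.single_smul, Finset.univ_sum_single]
    conv_rhs => rw [this]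
    rw [hTa]
    simp only [← G.eRepLinear_apply (M.mem_states ξ hξ), map_sum, map_smul, smul_eq_mul]
    exact Finset.sum_congr rfl fun k _ => mul_comm _ _
  have key : ∀ ξ ∈ M.dom, ∃ E : (Fin m → ℝ) ≃L[ℝ] (Fin m → ℝ), T ξ = E := by
    intro ξ hξ
    have hinj : Function.Injective (T ξ).toLinearMap := by
      rw [injective_iff_map_eq_zero]
      intro v hv
      refine M.eq_zero_of_hs_eRep_self G hξ fun j => ?_
      have := congrFun hv j
      exact (hTv ξ hξ v j).symm.trans this
    exact ⟨(LinearEquiv.ofInjectiveEndo _ hinj).toContinuousLinearEquiv, by ext; rfl⟩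
  refine ⟨fun k ξ => (T ξ).inverse (Pi.single k 1), fun k => ?_, fun ξ hξ k v => ?_⟩
  · refine ContDiffOn.clm_apply ?_ contDiffOn_const
    intro ξ hξ
    obtain ⟨E, hE⟩ := key ξ hξ
    have h1 := contDiffAt_map_inverse (n := ∞) E
    rw [← hE] at h1
    exact h1.comp_contDiffWithinAt ξ (hTs ξ hξ)
  · obtain ⟨E, hE⟩ := key ξ hξ
    have h1 : T ξ ((T ξ).inverse (Pi.single k 1)) = Pi.single k 1 := by
      rw [hE, ContinuousLinearMap.inverse_equiv]
      simp
    have h2 : (hs.flip (G.eRep (M.param ξ) (fderiv ℝ M.param ξ ((T ξ).inverse (Pi.single k 1)))))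
        ∘ₗ (fderiv ℝ M.param ξ).toLinearMap = LinearMap.proj k := by
      refine LinearMap.pi_ext' fun j => LinearMap.ext_ring ?_
      have h3 := (hTv ξ hξ _ j).symm.trans (congrFun h1 j)
      -- Symmetry of the Kronecker delta.
      have h4 : (Pi.single k (1 : ℝ) : Fin m → ℝ) j = (Pi.single j (1 : ℝ) : Fin m → ℝ) k := by
        simp [Pi.single_apply, eq_comm]
      exact h3.trans h4
    exact LinearMap.congr_fun h2 v

variable {M G}

/-- The coefficients are `g(∂_k, Y)`; by duality, `Y` minus the corresponding combination of the `a
k` is orthogonal to every `∂_j`. -/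
theorem IsDualFrame.eRepField_eq {a : Fin m → (Fin m → ℝ) → (Fin m → ℝ)} (ha : M.IsDualFrame G a)
    (y : (Fin m → ℝ) → (Fin m → ℝ)) {ξ : Fin m → ℝ} (hξ : ξ ∈ M.dom) :
    M.eRepField G y ξ = ∑ k, hs (M.push (fun _ => Pi.single k 1) ξ) (M.eRepField G y ξ)
      • M.eRepField G (a k) ξ := by
  have hρ := M.mem_states ξ hξ
  set c : Fin m → ℝ := fun k => hs (M.push (fun _ => Pi.single k 1) ξ) (M.eRepField G y ξ) with hc
  have h1 : ∀ u : Fin m → ℝ, G.eRep (M.param ξ) (fderiv ℝ M.param ξ u)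
      = (G.eRepLinear hρ ∘ₗ (fderiv ℝ M.param ξ).toLinearMap) u := fun _ => rfl
  have h2 : ∑ k, c k • M.eRepField G (a k) ξ
      = (G.eRepLinear hρ ∘ₗ (fderiv ℝ M.param ξ).toLinearMap) (∑ k, c k • a k ξ) := by
    rw [map_sum]
    simp only [map_smul]
    rfl
  have h3 : y ξ - ∑ k, c k • a k ξ = 0 := by
    refine M.eq_zero_of_hs_eRep_self G hξ fun j => ?_
    rw [h1, map_sub, map_sub, ← h2, map_sum]
    simp only [map_smul, ha.2 ξ hξ, smul_eq_mul]
    rw [sub_eq_zero]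
    change c j = _
    simp [Pi.single_apply]
  rw [h2, ← sub_eq_zero.1 h3]
  rfl

/-- `M` is e-autoparallel with m-affine coordinates if and only if the e-representations of the
dual frame are constant up to multiples of the identity. -/
theorem IsDualFrame.autoparallel_affine_iff {a : Fin m → (Fin m → ℝ) → (Fin m → ℝ)}
    (ha : M.IsDualFrame G a) : (M.IsEAutoparallel G ∧ M.IsMAffine G) ↔
      ∀ k, ∀ ξ ∈ M.dom, ∀ v, ∃ c : ℝ, fderiv ℝ (M.eRepField G (a k)) ξ v = c • idOp := by
  -- Derivative of the constant pairing `δ_jk`.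
  have hdiff : ∀ k, ∀ ξ ∈ M.dom, ∀ v j,
      hs (fderiv ℝ (M.push fun _ => Pi.single j 1) ξ v) (M.eRepField G (a k) ξ)
        + hs (M.push (fun _ => Pi.single j 1) ξ) (fderiv ℝ (M.eRepField G (a k)) ξ v) = 0 := by
    intro k ξ hξ v j
    rw [← fderiv_hs (M.differentiableAt_of_contDiffOn (M.contDiffOn_push (M.isField_const _)) hξ)
      (M.differentiableAt_of_contDiffOn (M.contDiffOn_eRepField G (ha.1 k)) hξ)]
    have h : (fun η => hs (M.push (fun _ => Pi.single j 1) η) (M.eRepField G (a k) η))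
        =ᶠ[nhds ξ] fun _ => (Pi.single j 1 : Fin m → ℝ) k := by
      filter_upwards [M.isOpen_dom.mem_nhds hξ] with η hη
      exact ha.2 η hη k _
    rw [h.fderiv_eq]
    simp
  rw [isMAffine_iff]
  constructor
  · rintro ⟨hauto, haff⟩ k ξ hξ v
    have hρ := M.mem_states ξ hξ
    obtain ⟨z, -, hz⟩ := hauto (fun _ => v) (a k) (M.isField_const v) (ha.1 k)
    have hspec := (M.eNablaAlong_spec G (fun _ => v) (M.contDiffOn_push (ha.1 k))
      (fun η hη => M.push_mem_traceless _ hη) hξ).2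
    rw [hz ξ hξ] at hspec
    -- By `hdiff` and m-affinity, the tangent vector representing the derivative of `L_k` is
    -- orthogonal to all `∂_j`.
    have hz0 : z ξ = 0 := by
      refine M.eq_zero_of_hs_eRep_self G hξ fun j => ?_
      have h1 := hspec _ (M.push_mem_traceless (fun _ => Pi.single j 1) hξ)
      rw [G.metric_eq hρ] at h1
      refine h1.trans ?_
      have h2 := hdiff k ξ hξ v j
      rw [haff j v _ (ha.1 k) ξ hξ, zero_add] at h2
      exact h2
    refine exists_eq_smul_idOp fun w hw => ?_
    refine (hspec w hw).symm.trans ?_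
    rw [push, hz0, map_zero, G.metric_comm hρ, G.metric_zero_right hρ]
  · intro h
    constructor
    · intro x y hx hy
      let c : Fin m → (Fin m → ℝ) → ℝ := fun k η =>
        hs (M.push (fun _ => Pi.single k 1) η) (M.eRepField G y η)
      have hc : ∀ k, ContDiffOn ℝ ∞ (c k) M.dom := fun k =>
        contDiffOn_hs (M.contDiffOn_push (M.isField_const _)) (M.contDiffOn_eRepField G hy)
      -- With `L_Y = ∑ c_k L_k` and each `L_k` constant modulo `I`, differentiation falls on the
      -- coefficients only.
      refine ⟨fun ξ => ∑ k, fderiv ℝ (c k) ξ (x ξ) • a k ξ, ?_, fun ξ hξ => ?_⟩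
      · exact ContDiffOn.sum fun k _ => (M.contDiffOn_fderiv (hc k) hx).smul (ha.1 k)
      · have hρ := M.mem_states ξ hξ
        obtain ⟨hw, hspec⟩ := M.eNablaAlong_spec G x (M.contDiffOn_push hy)
          (fun η hη => M.push_mem_traceless _ hη) hξ
        refine G.eq_of_metric_eq hρ hw (M.push_mem_traceless _ hξ) fun w hw => ?_
        rw [hspec w hw, G.metric_eq hρ]
        have h1 : M.eRepField G y =ᶠ[nhds ξ] fun η => ∑ k, c k η • M.eRepField G (a k) η := by
          filter_upwards [M.isOpen_dom.mem_nhds hξ] with η hη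
          exact ha.eRepField_eq y hη
        have h2 : HasFDerivAt (fun η => ∑ k, c k η • M.eRepField G (a k) η)
            (∑ k, (c k ξ • fderiv ℝ (M.eRepField G (a k)) ξ
              + (fderiv ℝ (c k) ξ).smulRight (M.eRepField G (a k) ξ))) ξ :=
          HasFDerivAt.fun_sum fun k _ =>
            (M.differentiableAt_of_contDiffOn (hc k) hξ).hasFDerivAt.smul
              (M.differentiableAt_of_contDiffOn (M.contDiffOn_eRepField G (ha.1 k)) hξ).hasFDerivAt
        have h3 : fderiv ℝ (M.eRepField G y) ξ = _ := h1.fderiv_eq.trans h2.fderiv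
        change hs w (fderiv ℝ (M.eRepField G y) ξ (x ξ)) = _
        rw [h3, push, map_sum, ← G.eRepLinear_apply hρ, map_sum, map_sum,
          _root_.sum_apply, map_sum]
        refine Finset.sum_congr rfl fun k _ => ?_
        obtain ⟨b, hb⟩ := h k ξ hξ (x ξ)
        have hw0 : hs w idOp = 0 := by rw [hs_comm]; exact hw
        simp only [map_smul, _root_.add_apply, _root_.smul_apply, hb,
          ContinuousLinearMap.smulRight_apply, map_add, hw0, smul_zero, zero_add]
        rfl
    · intro j v y hy ξ hξ
      -- It suffices to treat the frame; there `hdiff` turns the pairing into one of `∂_j ρ` with a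
      -- scalar operator, which vanishes since `∂_j ρ` is traceless.
      rw [ha.eRepField_eq y hξ, map_sum]
      refine Finset.sum_eq_zero fun k _ => ?_
      obtain ⟨b, hb⟩ := h k ξ hξ v
      have h0 : hs (M.push (fun _ => Pi.single j 1) ξ) idOp = 0 := by
        rw [hs_comm]; exact M.push_mem_traceless _ hξ
      have h1 := hdiff k ξ hξ v j
      rw [hb, map_smul, h0, smul_zero, add_zero] at h1
      rw [map_smul, h1, smul_zero]

end Model

/-! ### I.i.d. extensions -/

namespace Model
variable {m n : ℕ} (M : Model d m) (hn : 2 ≤ n)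

theorem hs_fderiv_idOp {ξ : Fin m → ℝ} (hξ : ξ ∈ M.dom) (v : Fin m → ℝ) :
    hs (fderiv ℝ M.param ξ v) idOp = 0 := by
  rw [hs_comm]
  exact M.push_mem_traceless (fun _ => v) hξ

/-- The derivative of the tensor power, paired with product operators. -/
theorem hs_fderiv_iidExtension {ξ : Fin m → ℝ} (hξ : ξ ∈ M.dom) (v : Fin m → ℝ)
    (B : Fin n → Herm d) :
    hs (fderiv ℝ (M.iidExtension n hn).param ξ v) (tensor B)
      = ∑ t, (∏ s ∈ Finset.univ.erase t, hs (M.param ξ) (B s)) * hs (fderiv ℝ M.param ξ v) (B t) := by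
  have h0 := fderiv_hs ((M.iidExtension n hn).differentiableAt_of_contDiffOn
    (M.iidExtension n hn).smooth hξ) (differentiableAt_const (tensor B)) v
  simp only [fderiv_fun_const, Pi.zero_apply, _root_.zero_apply, map_zero,
    add_zero] at h0
  rw [← h0]
  have h1 : (fun η => hs ((M.iidExtension n hn).param η) (tensor B))
      = fun η => ∏ t, hs (M.param η) (B t) := by
    funext η
    exact hs_tensor _ _
  have h2 : ∀ t, HasFDerivAt (fun η => hs (M.param η) (B t))
      ((LinearMap.toContinuousLinearMap (hs.flip (B t))).comp (fderiv ℝ M.param ξ)) ξ := fun t =>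
    (LinearMap.toContinuousLinearMap (hs.flip (B t))).hasFDerivAt.comp ξ
      (M.differentiableAt_of_contDiffOn M.smooth hξ).hasFDerivAt
  rw [h1, (HasFDerivAt.finsetProd (u := Finset.univ) fun t _ => h2 t).fderiv]
  simp

/-- Terms that differentiate another site contain the trace of a traceless operator, and the
undifferentiated factors have trace one. -/
theorem hs_fderiv_iidExtension_site {ξ : Fin m → ℝ} (hξ : ξ ∈ M.dom) (v : Fin m → ℝ) (t : Fin n)
    (A : Herm d) :
    hs (fderiv ℝ (M.iidExtension n hn).param ξ v) (site t A) = hs (fderiv ℝ M.param ξ v) A := by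
  rw [site_apply, M.hs_fderiv_iidExtension hn hξ, Finset.sum_eq_single t]
  · rw [Function.update_self, Finset.prod_eq_one, one_mul]
    intro s hs'
    rw [Function.update_of_ne (Finset.ne_of_mem_erase hs'), hs_state_idOp (M.mem_states ξ hξ)]
  · intro s _ hs'
    rw [Function.update_of_ne hs', M.hs_fderiv_idOp hξ, mul_zero]
  · simp

variable {G : InnerProductFamily d} {G' : InnerProductFamily (Fin n → d)}

/-- This is the only place where one-site multiplicativity is applied to the inner products. Against
a product operator it reproduces the Leibniz rule for `ρ^{⊗n}` term by term. -/
theorem eRep_iidExtension (h : OneSiteMultiplicative G G') {ξ : Fin m → ℝ} (hξ : ξ ∈ M.dom)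
    (v : Fin m → ℝ) :
    G'.eRep ((M.iidExtension n hn).param ξ) (fderiv ℝ (M.iidExtension n hn).param ξ v)
      = ∑ t, site t (G.eRep (M.param ξ) (fderiv ℝ M.param ξ v)) := by
  have hρ := M.mem_states ξ hξ
  symm
  apply G'.eRep_unique ((M.iidExtension n hn).mem_states ξ hξ)
  refine LinearMap.congr_fun (linearMap_ext_tensor fun B => ?_)
  rw [M.hs_fderiv_iidExtension hn hξ, map_sum, LinearMap.sum_apply]
  refine Finset.sum_congr rfl fun t _ => ?_
  refine (h _ hρ _ B ⟨t, fun s hs' => Function.update_of_ne hs' _ _⟩).trans ?_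
  rw [← Finset.mul_prod_erase _ _ (Finset.mem_univ t), Function.update_self, G.eRep_spec hρ,
    mul_comm]
  congr 1
  refine Finset.prod_congr rfl fun s hs' => ?_
  -- The factors at the other sites are `⟨I, B_s⟩ = Tr (ρ B_s)`.
  rw [Function.update_of_ne (Finset.ne_of_mem_erase hs'), G.symm _ hρ, G.unit _ hρ]

variable {M}

theorem eRepField_iidExtension (h : OneSiteMultiplicative G G') (a : (Fin m → ℝ) → (Fin m → ℝ))
    {ξ : Fin m → ℝ} (hξ : ξ ∈ M.dom) :
    (M.iidExtension n hn).eRepField G' (fun η => (n : ℝ)⁻¹ • a η) ξ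
      = (n : ℝ)⁻¹ • ∑ t, site t (M.eRepField G a ξ) := by
  rw [eRepField, push, M.eRep_iidExtension hn h hξ]
  simp only [← G.eRepLinear_apply (M.mem_states ξ hξ), map_smul, ← Finset.smul_sum]
  rfl

/-- Each of the `n` one-site copies pairs to the same value `v k`, which explains the factor `1/n`.
-/
theorem IsDualFrame.iidExtension (h : OneSiteMultiplicative G G')
    {a : Fin m → (Fin m → ℝ) → (Fin m → ℝ)} (ha : M.IsDualFrame G a) :
    (M.iidExtension n hn).IsDualFrame G' fun k η => (n : ℝ)⁻¹ • a k η := by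
  refine ⟨fun k => (ha.1 k).const_smul _, fun ξ hξ k v => ?_⟩
  have hn0 : (n : ℝ) ≠ 0 := by positivity
  rw [eRepField_iidExtension hn h (a k) hξ, map_smul, map_sum]
  simp only [M.hs_fderiv_iidExtension_site hn hξ, ha.2 ξ hξ]
  simp [hn0]

theorem autoparallel_affine_iff_iidExtension (h : OneSiteMultiplicative G G') :
    (M.IsEAutoparallel G ∧ M.IsMAffine G) ↔
      ((M.iidExtension n hn).IsEAutoparallel G' ∧ (M.iidExtension n hn).IsMAffine G') := by
  obtain ⟨a, ha⟩ := M.exists_isDualFrame G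
  rw [ha.autoparallel_affine_iff, (ha.iidExtension hn h).autoparallel_affine_iff]
  refine forall_congr' fun k => forall_congr' fun ξ => forall_congr' fun hξ => forall_congr' fun v => ?_
  have hn0 : (n : ℝ) ≠ 0 := by positivity
  -- Averaging over the sites is a fixed linear map, so it commutes with differentiation, and the
  -- two criteria can be compared pointwise.
  let S : Herm d →L[ℝ] Herm (Fin n → d) :=
    LinearMap.toContinuousLinearMap ((n : ℝ)⁻¹ • ∑ t, site t)
  have hS : ∀ A, S A = (n : ℝ)⁻¹ • ∑ t, site t A := fun A => by simp [S]
  have h1 : (M.iidExtension n hn).eRepField G' (fun η => (n : ℝ)⁻¹ • a k η)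
      =ᶠ[nhds ξ] fun η => S (M.eRepField G (a k) η) := by
    filter_upwards [M.isOpen_dom.mem_nhds hξ] with η hη
    rw [hS, eRepField_iidExtension hn h (a k) hη]
  have h2 : fderiv ℝ (fun η => S (M.eRepField G (a k) η)) ξ
      = S.comp (fderiv ℝ (M.eRepField G (a k)) ξ) :=
    (S.hasFDerivAt.comp ξ (M.differentiableAt_of_contDiffOn
      (M.contDiffOn_eRepField G (ha.1 k)) hξ).hasFDerivAt).fderiv
  rw [h1.fderiv_eq, h2, ContinuousLinearMap.comp_apply, hS,
    ← sum_site_eq_smul_idOp_iff (n := n) (by omega) (M.mem_states ξ hξ)]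
  constructor
  · rintro ⟨c, hc⟩
    exact ⟨(n : ℝ)⁻¹ * c, by rw [hc, mul_smul]⟩
  · rintro ⟨c, hc⟩
    exact ⟨n * c, by rw [mul_smul, ← hc, smul_smul, mul_inv_cancel₀ hn0, one_smul]⟩

end Model

/-! ### Inner products given by functions of the modular operator -/

/-- The eigenvectors of the modular operator span. -/
theorem linearMap_ext_modular {E : Type*} [AddCommGroup E] [Module ℂ E] {ρ : Matrix d d ℂ}
    (hρ : ρ.PosDef) {Φ Ψ : Matrix d d ℂ →ₗ[ℂ] E}
    (h : ∀ (c : ℝ) (V : Matrix d d ℂ), ρ * V * ρ⁻¹ = (c : ℂ) • V → Φ V = Ψ V) : Φ = Ψ := by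
  have hH := hρ.isHermitian
  let U : Matrix d d ℂ := (hH.eigenvectorUnitary).1
  have hU1 : U * star U = 1 := Unitary.coe_mul_star_self _
  have hU2 : star U * U = 1 := Unitary.coe_star_mul_self _
  let D : Matrix d d ℂ := Matrix.diagonal fun i => (hH.eigenvalues i : ℂ)
  have hD : ρ = U * D * star U := hH.spectral_theorem
  have hdet : IsUnit ρ.det := (Matrix.isUnit_iff_isUnit_det _).1 hρ.isUnit
  -- Rotated matrix units are eigenvectors, with eigenvalue the ratio of two eigenvalues of `ρ`.
  have hW : ∀ i j, ρ * (U * Matrix.single i j 1 * star U) * ρ⁻¹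
      = ((hH.eigenvalues i / hH.eigenvalues j : ℝ) : ℂ) • (U * Matrix.single i j 1 * star U) := by
    intro i j
    have hj : (hH.eigenvalues j : ℂ) ≠ 0 := by exact_mod_cast (hρ.eigenvalues_pos j).ne'
    have hDl : D * Matrix.single i j 1 = (hH.eigenvalues i : ℂ) • Matrix.single i j 1 := by
      ext k l
      by_cases h : i = k <;> simp [D, Matrix.diagonal_mul, Matrix.single_apply, h]
    have hDr : Matrix.single i j 1 * D = (hH.eigenvalues j : ℂ) • Matrix.single i j 1 := by
      ext k l
      by_cases h : j = l <;> simp [D, Matrix.mul_diagonal, Matrix.single_apply, h]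
    have h1 : ρ * (U * Matrix.single i j 1 * star U)
        = (hH.eigenvalues i : ℂ) • (U * Matrix.single i j 1 * star U) := by
      calc ρ * (U * Matrix.single i j 1 * star U)
          = U * (D * ((star U * U) * Matrix.single i j 1)) * star U := by
            rw [hD]; simp only [Matrix.mul_assoc]
        _ = _ := by
            rw [hU2, Matrix.one_mul, hDl, Matrix.mul_smul, Matrix.smul_mul]
    have h2 : (U * Matrix.single i j 1 * star U) * ρ
        = (hH.eigenvalues j : ℂ) • (U * Matrix.single i j 1 * star U) := by
      calc (U * Matrix.single i j 1 * star U) * ρ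
          = U * (Matrix.single i j 1 * ((star U * U) * D)) * star U := by
            rw [hD]; simp only [Matrix.mul_assoc]
        _ = _ := by
            rw [hU2, Matrix.one_mul, hDr, Matrix.mul_smul, Matrix.smul_mul]
    have h3 : (U * Matrix.single i j 1 * star U) * ρ⁻¹
        = (hH.eigenvalues j : ℂ)⁻¹ • (U * Matrix.single i j 1 * star U) := by
      have h4 := congrArg (fun V => (hH.eigenvalues j : ℂ)⁻¹ • (V * ρ⁻¹)) h2
      simp only [Matrix.smul_mul, smul_smul, inv_mul_cancel₀ hj, one_smul] at h4
      rw [← h4, Matrix.mul_nonsing_inv_cancel_right _ _ hdet]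
    rw [h1, Matrix.smul_mul, h3, smul_smul, Complex.ofReal_div, div_eq_mul_inv]
  refine LinearMap.ext fun V => ?_
  have hV : V = ∑ i, ∑ j, (star U * V * U) i j • (U * Matrix.single i j 1 * star U) := by
    have h1 : V = U * (star U * V * U) * star U := by
      calc V = (U * star U) * V * (U * star U) := by simp [hU1]
        _ = _ := by simp only [Matrix.mul_assoc]
    conv_lhs => rw [h1, Matrix.matrix_eq_sum_single (star U * V * U)]
    simp only [Matrix.mul_sum, Matrix.sum_mul]
    refine Finset.sum_congr rfl fun i _ => Finset.sum_congr rfl fun j _ => ?_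
    rw [← Matrix.smul_mul, ← Matrix.mul_smul, Matrix.smul_single, smul_eq_mul, mul_one]
  rw [hV]
  simp only [map_sum, map_smul]
  refine Finset.sum_congr rfl fun i _ => Finset.sum_congr rfl fun j _ => ?_
  rw [h _ _ (hW i j)]

theorem mat_tensorPow (n : ℕ) (ρ : Herm d) : (tensorPow n ρ).mat = piKron fun _ => ρ.mat := rfl

/-- The modular operator of a tensor power acts on one-site operators site by site. -/
theorem modular_piKron_update {n : ℕ} (t : Fin n) {ρ : Matrix d d ℂ} (hρ : ρ.PosDef)
    (V : Matrix d d ℂ) :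
    (piKron fun _ => ρ) * piKron (Function.update (fun _ => 1) t V) * (piKron fun _ : Fin n => ρ)⁻¹
      = piKron (Function.update (fun _ => 1) t (ρ * V * ρ⁻¹)) := by
  have h : ρ * ρ⁻¹ = 1 :=
    Matrix.mul_nonsing_inv _ ((Matrix.isUnit_iff_isUnit_det _).1 hρ.isUnit)
  have hinv : (piKron fun _ : Fin n => ρ)⁻¹ = piKron fun _ => ρ⁻¹ := by
    refine Matrix.inv_eq_right_inv ?_
    rw [piKron_mul, h, piKron_one]
  rw [hinv, piKron_mul, piKron_mul]
  congr 1
  funext s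
  by_cases hs : s = t
  · subst hs; simp
  · simp [hs, h]

/-! ### Families that are one-site multiplicative. -/

theorem TensorMultiplicative.oneSiteMultiplicative {n : ℕ} {G : InnerProductFamily d}
    {G' : InnerProductFamily (Fin n → d)} (h : TensorMultiplicative G G') :
    OneSiteMultiplicative G G' := fun ρ hρ A B _ => h ρ hρ A B

theorem IsInducedBy.oneSiteMultiplicative {n : ℕ} {f : ℝ → ℝ} {G : InnerProductFamily d}
    {G' : InnerProductFamily (Fin n → d)} (hG : IsInducedBy f G) (hG' : IsInducedBy f G') :
    OneSiteMultiplicative G G' := by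
  rintro ρ hρ A B ⟨t, ht⟩
  have hρ' := tensorPow_mem_states n hρ
  obtain ⟨F, hF, hFG⟩ := hG ρ hρ
  obtain ⟨F', hF', hFG'⟩ := hG' _ hρ'
  -- Both sides are linear, so it suffices to compare them on eigenvectors of the modular operator
  -- of `ρ`, where each multiplies by `f c`.
  have hcomm : F' ∘ₗ (piKronMultilinear d n).toLinearMap (fun _ => 1) t
      = (piKronMultilinear d n).toLinearMap (fun _ => 1) t ∘ₗ F := by
    refine linearMap_ext_modular hρ.1 fun c V hV => ?_
    rw [LinearMap.comp_apply, LinearMap.comp_apply, hF c V hV, map_smul]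
    refine hF' c _ ?_
    refine (modular_piKron_update t hρ.1 V).trans ?_
    rw [hV, piKron_update_smul]
    rfl
  have hA : A = Function.update (fun _ => idOp) t (A t) := by
    funext s
    by_cases hs : s = t
    · subst hs; simp
    · rw [Function.update_of_ne hs, ht s hs]
  have hFA : F' (tensor A).mat = piKron (Function.update (fun _ => 1) t (F (A t).mat)) := by
    rw [hA, mat_tensor_update_idOp, ← hA]
    exact LinearMap.congr_fun hcomm (A t).mat
  have key : (G'.form (tensorPow n ρ) (tensor A) (tensor B) : ℂ)
      = ∏ s, (G.form ρ (A s) (B s) : ℂ) := by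
    -- Symmetry moves the one-site operator into the second argument, on which `F'` acts.
    rw [G'.symm _ hρ', hFG', hFA, mat_tensorPow, piKron_mul]
    change (piKron (fun s => (B s).mat) * _).trace = _
    rw [piKron_mul, trace_piKron]
    refine Finset.prod_congr rfl fun s _ => ?_
    rw [G.symm _ hρ]
    by_cases hs' : s = t
    · subst hs'
      rw [Function.update_self, hFG]
    -- At the other sites the factor is `Tr (B_s ρ)`, which the unit condition identifies with
    -- `⟨B_s, I⟩_ρ`.
    · rw [Function.update_of_ne hs', ht s hs', G.unit _ hρ, Matrix.one_mul, trace_eq_hs, hs_comm]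
  exact_mod_cast key

theorem sld_form_apply (ρ A B : Herm d) :
    (sld d).form ρ A B = (Matrix.trace (ρ.mat * A.mat * B.mat)).re := rfl

theorem sld_oneSiteMultiplicative (n : ℕ) :
    OneSiteMultiplicative (sld d) (sld (Fin n → d)) := by
  rintro ρ hρ A B ⟨t, ht⟩
  -- Where `A s = I`, the trace `Tr (ρ B_s)` of a product of two Hermitian operators is already
  -- real, so at most the factor at `t` is complex.
  have h1 : ∀ s ∈ Finset.univ.erase t, Matrix.trace (ρ.mat * (A s).mat * (B s).mat)
      = ((sld d).form ρ (A s) (B s) : ℂ) := fun s hs' => by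
    rw [sld_form_apply, ht s (Finset.ne_of_mem_erase hs'), mat_idOp, Matrix.mul_one, trace_eq_hs,
      Complex.ofReal_re]
  rw [sld_form_apply, mat_tensorPow]
  change (Matrix.trace (_ * piKron (fun s => (A s).mat) * piKron (fun s => (B s).mat))).re = _
  rw [piKron_mul, piKron_mul, trace_piKron, ← Finset.mul_prod_erase _ _ (Finset.mem_univ t),
    Finset.prod_congr rfl h1, ← Complex.ofReal_prod, Complex.re_mul_ofReal,
    ← Finset.mul_prod_erase _ _ (Finset.mem_univ t)]
  rfl

end QStat

end

theorem mainTheorem12 {d : Type*} [Fintype d] [DecidableEq d] (n : ℕ) (hn : 2 ≤ n) :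
    (∀ (G : QStat.InnerProductFamily d) (G' : QStat.InnerProductFamily (Fin n → d)),
      QStat.OneSiteMultiplicative G G' →
        ∀ (m : ℕ) (M : QStat.Model d m),
          (M.IsEAutoparallel G ∧ M.IsMAffine G) ↔
            ((M.iidExtension n hn).IsEAutoparallel G' ∧ (M.iidExtension n hn).IsMAffine G')) ∧
    (∀ (G : QStat.InnerProductFamily d) (G' : QStat.InnerProductFamily (Fin n → d)),
      QStat.TensorMultiplicative G G' → QStat.OneSiteMultiplicative G G') ∧
    (∀ (f : ℝ → ℝ) (G : QStat.InnerProductFamily d) (G' : QStat.InnerProductFamily (Fin n → d)),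
      QStat.IsInducedBy f G → QStat.IsInducedBy f G' → QStat.OneSiteMultiplicative G G') ∧
    QStat.OneSiteMultiplicative (QStat.sld d) (QStat.sld (Fin n → d)) :=
  ⟨fun _ _ h _ _ => QStat.Model.autoparallel_affine_iff_iidExtension hn h,
    fun _ _ h => h.oneSiteMultiplicative,
    fun _ _ _ h h' => h.oneSiteMultiplicative h',
    QStat.sld_oneSiteMultiplicative n⟩
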